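/- \textbf{Types and their semantics.} Types are $\sigma,\tau ::= \mathtt{unit}\mid\mathtt{void}\mid\mathtt{int}\mid\mathtt{real}\mid\sigma+\tau\mid\sigma\times\tau\mid\sigma\to\tau\mid D\tau$. Each type denotes a pointed dcpo (with its Scott topology): $[\![\mathtt{void}]\!]=\{\bot\}$, $[\![\mathtt{unit}]\!]=\{*\}_\bot$, $[\![\mathtt{int}]\!]=\mathbb Z_\bot$, $[\![\mathtt{real}]\!]=\mathbf I\mathbb R_\bot$ (the closed bounded intervals $[a,b]$, $a\le b$, ordered by reverse inclusion, plus a bottom element), $[\![\sigma+\tau]\!]=([\![\sigma]\!]+[\![\tau]\!])_\bot$, $[\![\sigma\times\tau]\!]=[\![\sigma]\!]\times[\![\tau]\!]$, $[\![\sigma\to\tau]\!]=$ the Scott-continuous maps with the pointwise order, and $[\![D\tau]\!]=$ the dcpo of minimal valuations on $[\![\tau]\!]$. Here a continuous valuation on a space $X$ is a map $\nu$ from the open sets of $X$ to $[0,\infty]$ that is Scott-continuous and satisfies $\nu(\emptyset)=0$ and $\nu(U\cup V)+\nu(U\cap V)=\nu(U)+\nu(V)$; valuations are ordered pointwise; the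 minimal ones form the smallest set that contains the finite sums $\sum_i a_i\delta_{x_i}$ ($0\le a_i<\infty$) and is closed under directed suprema. \textbf{Terms.} A signature $\Sigma$ consists of typed constants $\underline f$, each with an element $f$ of the semantics of its type, and a set of measures on $\mathbb R$. It always contains $\underline *:\mathtt{unit}$, $\underline n:\mathtt{int}$ ($n\in\mathbb Z$) and, for generalized terms, the constants $\underline{\mathbf a}:\mathtt{real}$ ($\mathbf a\in\mathbf I\mathbb R_\bot$), which are its only constants of type $\mathtt{real}$ and denote $*$, $n$, $\mathbf a$; one writes $\underline a$ for $\underline{[a,a]}$ if $a\in\mathbb R$. Terms are the simply typed terms built from variables, constants, $\lambda x.M$, $MN$, $\mathtt{rec}\,M:\tau$ ($M:\tau\to\tau$), $\mathtt{ret}\,M:D\tau$ ($M:\tau$), $\mathtt{do}\{x\leftarrow M;N\}:D\tau$ ($M:D\sigma$, and $N:D\tau$ with $x:\sigma$), $\langle M,N\rangle$, $\pi_1M$, $\pi_2M$, $\iota_1M$, $\iota_2M$, $\mathtt{case}\,M\,N\,P:\upsilon$ ($M:\sigma+\tau$, $N:\sigma\to\upsilon$, $P:\tau\to\upsilon$),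 $\mathtt{sample}[\mu]:D\,\mathtt{real}$ and $\mathtt{score}\,M:D\,\mathtt{unit}$ ($M:\mathtt{real}$). Generalized ISPCF terms are closed terms, up to renaming of bound variables. The semantics $[\![M]\!]$ is the standard one: $\lambda$, application, pairs and injections as usual ($\mathtt{case}$ is strict in its first argument), $\mathtt{rec}$ is the least fixed point, $[\![\mathtt{ret}\,M]\!]=\delta_{[\![M]\!]}$, $[\![\mathtt{do}\{x\leftarrow M;N\}]\!](U)=\int [\![N]\!]_{x\mapsto v}(U)\,d[\![M]\!](v)$, $[\![\mathtt{sample}[\mu]]\!]$ is the image of $\mu$ under $r\mapsto[r,r]$, and $[\![\mathtt{score}\,M]\!]=|[\![M]\!]|\cdot\delta_*$, where $|[a,b]|=\max(0,a,-b)$ and $|\bot|=0$. Basic types are $\mathtt{unit},\mathtt{void},\mathtt{int},\mathtt{real}$; observable types are those without $\to$ and $D$. Observable elements are the elements $\ne\bot$ at basic types, the pairs of observable elements at product types, and the elements $\iota_1 a$, $\iota_2 b$ with $a$, $b$ observable at sum types. For each observable element $a$ let $\underline a$ be the corresponding term built from constants, pairs and injections. \emph{$\Sigma$ consists of strictly observable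 first-order constants} if each $\underline f$ in $\Sigma$ has a type $\sigma_1\to\cdots\to\sigma_k\to\tau$ with all $\sigma_i$ basic and $\tau$ observable ($k=\alpha(\underline f)$ is its arity); $f(v_1)\cdots(v_k)$ is always observable or equal to $\bot$, and is $\bot$ if some $v_i$ is $\bot$; and each listed constant of observable type (the constants $\underline{\mathbf a}$ aside) is of basic type and has an observable semantics. \textbf{Operational semantics.} With $\underline a$ ranging over zero-ary constants of basic types, let $$E ::= E^0\mid \mathtt{ret}\,E\mid\langle E,M\rangle\mid\langle V,E\rangle\mid\iota_1E\mid\iota_2E,$$ $$E^0 ::= []\mid\mathtt{score}\,E^0\mid E^0N\mid\mathtt{do}\{x\leftarrow E^0;N\}\mid\underline f\,\underline a_1\cdots\underline a_{i-1}E^0\ (i\le\alpha(\underline f))\mid\mathtt{case}\,E^0NP\mid\pi_1E^0\mid\pi_2E^0,$$ $$V ::= \underline a\mid\lambda x.M\mid\mathtt{ret}\,V\mid\langle V,V\rangle\mid\iota_1V\mid\iota_2V\mid\underline f\,\underline a_1\cdots\underline a_i\ (i<\alpha(\underline f)).$$ Order the terms of each type by: $M\le N$ iff $M,N$ are equal up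 to the constants of type $\mathtt{real}$, and each such constant in $M$ is $\le$ the one at the same place in $N$. Give them the Scott topology. The map $Next$ from terms to continuous valuations on the terms of the same type is given by \begin{itemize} \item $Next(L)=\delta_R$ if $L$, $R$ are $E[\mathtt{rec}\,M]$, $E[M(\mathtt{rec}\,M)]$; or $E[(\lambda x.M)N]$, $E[M[x:=N]]$; or $E[\pi_i\langle M_1,M_2\rangle]$, $E[M_i]$; or $E[\mathtt{case}(\iota_1M)NP]$, $E[NM]$; or $E[\mathtt{case}(\iota_2M)NP]$, $E[PM]$; or $E^0[\mathtt{do}\{x\leftarrow\mathtt{ret}\,M;N\}]$, $E^0[N[x:=M]]$; \item $Next(E^0[\mathtt{sample}[\mu]])$ is the image of $\mu$ under $a\mapsto E^0[\mathtt{ret}\,\underline a]$, $a\in\mathbb R$; \item $Next(E^0[\mathtt{score}\,\underline{\mathbf a}])=|\mathbf a|\cdot\delta_{E^0[\mathtt{ret}\,\underline *]}$; \item if $k=\alpha(\underline f)\ne0$, $Next(E[\underline f\,\underline a_1\cdots\underline a_k])=\delta_{E[\underline{f(a_1)\cdots(a_k)}]}$ if $f(a_1)\cdots(a_k)$ is observable,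 and $0$ otherwise (in the latter case the term is called \emph{blocked}); \item $Next(M)=0$ for all other terms $M$, which are called \emph{normal forms}; let $Norm$ be the set of these. \end{itemize} Let $Next^{\le0}(M)=\delta_M$ if $M\in Norm$, and $0$ otherwise; $Next^{\le1}(M)=Next(M)+Next^{\le0}(M)$; for $n\ge1$, $Next^{\le n+1}(M)(W)=\int Next^{\le n}(N)(W)\,dNext^{\le1}(M)(N)$; and $Next^*(M)(W)=\sup_{n\ge1}Next^{\le n}(M)(W\cap Norm)$ for open $W$. \textbf{Proposition (Soundness).} Let $\Sigma$ consist of strictly observable first-order constants. For every type $\tau$, every generalized ISPCF term $M:D\tau$ and every Scott-open $U\subseteq[\![\tau]\!]$, $$[\![M]\!](U)\ \ge\ Next^*(M)(U'),$$ where $U'$ is the (Scott-open) set of terms $\mathtt{ret}\,V$ such that $V$ is a normal form of type $\tau$ with $[\![V]\!]\in U$. -/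

import Mathlib

open TopologicalSpace
open scoped ENNReal NNReal

noncomputable section

namespace ISPCF

/-- A pointed dcpo: every directed subset (the empty one included) has a least upper bound. -/
structure PDcpo where
  carrier : Type
  [cpo : CompletePartialOrder carrier]

instance : CoeSort PDcpo Type := ⟨PDcpo.carrier⟩

instance (X : PDcpo) : CompletePartialOrder X := X.cpo

/-- Every dcpo carries its Scott topology. -/
instance (X : PDcpo) : TopologicalSpace X := Topology.scott X Set.univ

instance (X : PDcpo) : Topology.IsScott X Set.univ := ⟨rfl⟩

theorem PDcpo.isOpen_iff {X : PDcpo} {s : Set X} : IsOpen s ↔ IsUpperSet s ∧ DirSupInacc s := by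
  rw [Topology.IsScott.isOpen_iff_isUpperSet_and_dirSupInaccOn (D := Set.univ), dirSupInaccOn_univ]

theorem continuous_of_scott {X Y : PDcpo} {f : X → Y} (h : ScottContinuous f) : Continuous f := by
  exact (Topology.IsScott.scottContinuousOn_iff_continuous (D := Set.univ) (by simp)).1
    h.scottContinuousOn

theorem lsc_of_scott {X : PDcpo} {h : X → ℝ≥0∞} (hh : ScottContinuous h) :
    LowerSemicontinuous h := by
  rw [lowerSemicontinuous_iff_isOpen_preimage]
  intro y
  rw [PDcpo.isOpen_iff]
  refine ⟨fun a b hab ha => lt_of_lt_of_le ha (hh.monotone hab), ?_⟩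
  intro d hd hdir a ha hya
  have := hh hd hdir ha
  obtain ⟨b, ⟨c, hc, rfl⟩, hb⟩ := (lt_isLUB_iff this).1 hya
  exact ⟨c, hc, hb⟩

theorem isLUB_image_apply {ι α : Type*} [CompleteLattice α] {d : Set ι} (g : ι → α) (a : α) :
    IsLUB (g '' d) a ↔ a = ⨆ i ∈ d, g i := by
  constructor
  · intro h
    rw [← sSup_image]
    exact h.sSup_eq.symm
  · rintro rfl
    rw [← sSup_image]
    exact isLUB_sSup _

theorem scottContinuous_ennreal {X : Type*} [Preorder X] {f : X → ℝ≥0∞} (hm : Monotone f)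
    (h : ∀ d : Set X, d.Nonempty → DirectedOn (· ≤ ·) d → ∀ a, IsLUB d a → f a ≤ ⨆ i ∈ d, f i) :
    ScottContinuous f := by
  intro d hd hdir a ha
  rw [isLUB_image_apply]
  exact le_antisymm (h d hd hdir a ha) (iSup₂_le fun i hi => hm (ha.1 hi))

theorem ScottContinuous.apply_eq {X : Type*} [Preorder X] {f : X → ℝ≥0∞} (h : ScottContinuous f)
    {d : Set X} (hd : d.Nonempty) (hdir : DirectedOn (· ≤ ·) d) {a : X} (ha : IsLUB d a) :
    f a = ⨆ i ∈ d, f i := (isLUB_image_apply _ _).1 (h hd hdir ha)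

theorem biSup_add_directed {X : Type*} [Preorder X] {d : Set X} (hdir : DirectedOn (· ≤ ·) d)
    {f g : X → ℝ≥0∞} (hf : Monotone f) (hg : Monotone g) :
    (⨆ i ∈ d, f i) + (⨆ i ∈ d, g i) = ⨆ i ∈ d, (f i + g i) := by
  rw [iSup_subtype', iSup_subtype', iSup_subtype']
  refine ENNReal.iSup_add_iSup fun i j => ?_
  obtain ⟨k, hk, hik, hjk⟩ := hdir i i.2 j j.2
  exact ⟨⟨k, hk⟩, add_le_add (hf hik) (hg hjk)⟩

/-! ### Continuous valuations -/

/-- A continuous valuation on a topological space: a strict, modular, Scott-continuous map from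
the lattice of open sets to the extended nonnegative reals. -/
structure Valuation (X : Type*) [TopologicalSpace X] where
  toFun : Opens X → ℝ≥0∞
  strict : toFun ⊥ = 0
  modular : ∀ U V, toFun (U ⊔ V) + toFun (U ⊓ V) = toFun U + toFun V
  continuous : ScottContinuous toFun

namespace Valuation

variable {X Y : Type*} [TopologicalSpace X] [TopologicalSpace Y]

instance : CoeFun (Valuation X) (fun _ => Opens X → ℝ≥0∞) := ⟨toFun⟩

theorem toFun_injective : Function.Injective (toFun : Valuation X → _) := by
  rintro ⟨⟩ ⟨⟩ h; congr

@[ext] theorem ext {μ ν : Valuation X} (h : ∀ U, μ U = ν U) : μ = ν :=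
  toFun_injective (funext h)

/-- The stochastic order. -/
instance : PartialOrder (Valuation X) := PartialOrder.lift toFun toFun_injective

theorem le_def {μ ν : Valuation X} : μ ≤ ν ↔ ∀ U, μ U ≤ ν U := Iff.rfl

theorem mono (ν : Valuation X) {U V : Opens X} (h : U ≤ V) : ν U ≤ ν V := ν.continuous.monotone h

/-- Pointwise supremum of a directed set of continuous valuations. -/
def dirSup (d : Set (Valuation X)) (hd : DirectedOn (· ≤ ·) d) : Valuation X where
  toFun U := ⨆ ν ∈ d, ν U
  strict := by simp [Valuation.strict]
  modular U V := by
    rw [biSup_add_directed hd (f := fun ν => ν (U ⊔ V)) (g := fun ν => ν (U ⊓ V))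
        (fun _ _ h => h _) (fun _ _ h => h _),
      biSup_add_directed hd (f := fun ν => ν U) (g := fun ν => ν V)
        (fun _ _ h => h _) (fun _ _ h => h _)]
    simp only [modular]
  continuous := by
    refine scottContinuous_ennreal (fun U V h => iSup₂_mono fun ν _ => ν.mono h) ?_
    intro s hs hdir a ha
    refine iSup₂_le fun ν hν => ?_
    rw [ScottContinuous.apply_eq ν.continuous hs hdir ha]
    exact iSup₂_mono fun U _ => le_iSup₂ (f := fun (ν : Valuation X) (_ : ν ∈ d) => ν U) ν hν

instance : Zero (Valuation X) where
  zero :=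
    { toFun := fun _ => 0
      strict := rfl
      modular := fun _ _ => rfl
      continuous := ScottContinuous.const _ }

@[simp] theorem zero_apply (U : Opens X) : (0 : Valuation X) U = 0 := rfl

theorem isLUB_dirSup (d : Set (Valuation X)) (hd : DirectedOn (· ≤ ·) d) :
    IsLUB d (dirSup d hd) :=
  ⟨fun ν hν U => le_iSup₂ (f := fun (ν : Valuation X) (_ : ν ∈ d) => ν U) ν hν,
    fun _ hμ U => iSup₂_le fun _ hν => hμ hν U⟩

theorem isLUB_iff {d : Set (Valuation X)} (hd : DirectedOn (· ≤ ·) d) {ν : Valuation X} :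
    IsLUB d ν ↔ ∀ U, ν U = ⨆ μ ∈ d, μ U := by
  constructor
  · intro h U
    rw [h.unique (isLUB_dirSup d hd)]
    rfl
  · intro h
    have : ν = dirSup d hd := ext h
    rw [this]
    exact isLUB_dirSup d hd

instance : Add (Valuation X) where
  add μ ν :=
    { toFun := fun U => μ U + ν U
      strict := by simp [strict]
      modular := fun U V => by
        rw [add_add_add_comm, modular, modular, add_add_add_comm]
      continuous := by
        refine scottContinuous_ennreal (fun U V h => add_le_add (μ.mono h) (ν.mono h)) ?_
        intro d hd hdir a ha
        rw [ScottContinuous.apply_eq μ.continuous hd hdir ha,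
          ScottContinuous.apply_eq ν.continuous hd hdir ha,
          biSup_add_directed hdir μ.continuous.monotone ν.continuous.monotone] }

@[simp] theorem add_apply (μ ν : Valuation X) (U : Opens X) : (μ + ν) U = μ U + ν U := rfl

instance : SMul ℝ≥0∞ (Valuation X) where
  smul r ν :=
    { toFun := fun U => r * ν U
      strict := by simp [strict]
      modular := fun U V => by
        rw [← mul_add, ← mul_add, modular]
      continuous := by
        refine scottContinuous_ennreal (fun U V h => mul_le_mul_right (ν.mono h) r) ?_
        intro d hd hdir a ha
        rw [ScottContinuous.apply_eq ν.continuous hd hdir ha]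
        simp [ENNReal.mul_iSup] }

@[simp] theorem smul_apply (r : ℝ≥0∞) (ν : Valuation X) (U : Opens X) : (r • ν) U = r * ν U := rfl

open Classical in
/-- The Dirac valuation. -/
def dirac (x : X) : Valuation X where
  toFun U := if x ∈ U then 1 else 0
  strict := by simp
  modular U V := by
    by_cases h1 : x ∈ U <;> by_cases h2 : x ∈ V <;> simp [h1, h2]
  continuous := by
    refine scottContinuous_ennreal (fun U V h => ?_) ?_
    · by_cases h1 : x ∈ U
      · simp [h1, h h1]
      · simp [h1]
    · intro d hd hdir a ha
      by_cases h1 : x ∈ a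
      · rw [← ha.sSup_eq, Opens.mem_sSup] at h1
        obtain ⟨U, hU, hx⟩ := h1
        refine le_trans ?_ (le_iSup₂ (f := fun (U : Opens X) (_ : U ∈ d) =>
          if x ∈ U then (1 : ℝ≥0∞) else 0) U hU)
        simp only [hx, if_true]
        split_ifs <;> simp
      · simp [h1]

open Classical in
theorem dirac_apply (x : X) (U : Opens X) : dirac x U = if x ∈ U then 1 else 0 := rfl

/-- The image valuation along a continuous map. -/
def map (f : C(X, Y)) (ν : Valuation X) : Valuation Y where
  toFun V := ν (V.comap f)
  strict := by simpa using ν.strict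
  modular U V := by simpa using ν.modular (U.comap f) (V.comap f)
  continuous := by
    refine scottContinuous_ennreal (fun U V h => ν.mono (Opens.comap_mono f h)) ?_
    intro d hd hdir a ha
    have h1 : IsLUB (Opens.comap f '' d) (a.comap f) := by
      rw [isLUB_image_apply, ← ha.sSup_eq]
      ext x
      simp
    rw [ScottContinuous.apply_eq ν.continuous (hd.image _) ?_ h1]
    · rw [iSup_image]
    · rintro _ ⟨U, hU, rfl⟩ _ ⟨V, hV, rfl⟩
      obtain ⟨W, hW, h1, h2⟩ := hdir U hU V hV
      exact ⟨_, ⟨W, hW, rfl⟩, Opens.comap_mono f h1, Opens.comap_mono f h2⟩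

@[simp] theorem map_apply (f : C(X, Y)) (ν : Valuation X) (V : Opens Y) :
    map f ν V = ν (V.comap f) := rfl

/-- The restriction of a measure to the open sets of a second-countable space. -/
def ofMeasure [SecondCountableTopology X] [MeasurableSpace X] [OpensMeasurableSpace X]
    (μ : MeasureTheory.Measure X) : Valuation X where
  toFun U := μ U
  strict := by simp
  modular U V := by
    simpa using MeasureTheory.measure_union_add_inter (μ := μ) (U : Set X) V.isOpen.measurableSet
  continuous := by
    refine scottContinuous_ennreal (fun U V h => MeasureTheory.measure_mono h) ?_
    intro d hd hdir a ha
    obtain ⟨T, hT, hTd, hTU⟩ := isOpen_sUnion_countable ((fun U : Opens X => (U : Set X)) '' d)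
      (by rintro _ ⟨U, _, rfl⟩; exact U.isOpen)
    have ha' : (a : Set X) = ⋃₀ T := by
      rw [hTU, ← ha.sSup_eq]; simp [Set.sUnion_image]
    rw [ha']
    obtain ⟨U0, hU0⟩ := hd
    rcases T.eq_empty_or_nonempty with rfl | hne
    · simp
    obtain ⟨f, rfl⟩ := hT.exists_eq_range hne
    rw [Set.sUnion_range, MeasureTheory.measure_iUnion_eq_iSup_accumulate]
    refine iSup_le fun n => ?_
    have : ∃ U ∈ d, Set.accumulate f n ⊆ (U : Set X) := by
      induction n with
      | zero =>
        obtain ⟨U, hU, hU'⟩ := hTd ⟨0, rfl⟩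
        refine ⟨U, hU, ?_⟩
        simp only [Set.accumulate_zero_nat, ← hU']
        exact subset_rfl
      | succ n ih =>
        obtain ⟨U, hU, hU'⟩ := ih
        obtain ⟨V, hV, hV'⟩ := hTd ⟨n + 1, rfl⟩
        obtain ⟨W, hW, h1, h2⟩ := hdir U hU V hV
        refine ⟨W, hW, ?_⟩
        rw [Set.accumulate_succ]
        refine Set.union_subset (hU'.trans h1) ?_
        rw [← hV']
        exact h2
    obtain ⟨U, hU, hU'⟩ := this
    exact (MeasureTheory.measure_mono hU').trans
      (le_iSup₂ (f := fun (U : Opens X) (_ : U ∈ d) => μ (U : Set X)) U hU)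

theorem ofMeasure_apply [SecondCountableTopology X] [MeasurableSpace X] [OpensMeasurableSpace X]
    (μ : MeasureTheory.Measure X) (U : Opens X) : ofMeasure μ U = μ (U : Set X) := rfl

/-- The integral of `h` against `ν`, by the Choquet formula. The interior plays no role when `h` is
lower semicontinuous, since the sets `{x | t < h x}` are then open. -/
def integral (ν : Valuation X) (h : X → ℝ≥0∞) : ℝ≥0∞ :=
  ∫⁻ t in Set.Ioi (0 : ℝ), ν (Opens.interior {x | ENNReal.ofReal t < h x})

end Valuation

theorem exists_countable_biSup {ι : Type*} {d : Set ι} (hd : d.Nonempty) (g : ι → ℝ≥0∞) :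
    ∃ u : ℕ → ι, (∀ n, u n ∈ d) ∧ ⨆ n, g (u n) = ⨆ i ∈ d, g i := by
  obtain ⟨s, -, hs, hs'⟩ := exists_seq_tendsto_sSup (S := g '' d) (hd.image _) (OrderTop.bddAbove _)
  choose u hu using hs'
  refine ⟨u, fun n => (hu n).1, le_antisymm (iSup_le fun n => le_iSup₂ (f := fun i (_ : i ∈ d) => g i) _ (hu n).1) ?_⟩
  rw [← sSup_image]
  refine le_of_tendsto' hs fun n => ?_
  rw [← (hu n).2]
  exact le_iSup (fun n => g (u n)) n

/-- Monotone convergence for directed families of antitone functions. -/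
theorem lintegral_biSup_antitone {ι : Type*} [Preorder ι] {d : Set ι} (hd : d.Nonempty)
    (hdir : DirectedOn (· ≤ ·) d) (φ : ι → ℝ → ℝ≥0∞) (hm : Monotone φ)
    (ha : ∀ i, Antitone (φ i))
    (hr : ∀ i t, 0 < t → φ i t = ⨆ s ∈ Set.Ioi t, φ i s) :
    ∫⁻ t in Set.Ioi (0 : ℝ), (⨆ i ∈ d, φ i t) = ⨆ i ∈ d, ∫⁻ t in Set.Ioi (0 : ℝ), φ i t := by
  refine le_antisymm ?_ (iSup₂_le fun i hi => MeasureTheory.lintegral_mono fun t =>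
    le_iSup₂ (f := fun i (_ : i ∈ d) => φ i t) i hi)
  choose u hu hu' using fun q : ℚ => exists_countable_biSup hd (fun i => φ i (q : ℝ))
  obtain ⟨i0, hi0⟩ := hd
  choose g hgd hg1 hg2 using hdir
  obtain ⟨e, he⟩ := exists_surjective_nat (ℚ × ℕ)
  let w : ℕ → d := fun n => ⟨u (e n).1 (e n).2, hu _ _⟩
  let j : ℕ → d := fun n => Nat.rec ⟨i0, hi0⟩
    (fun n x => ⟨g x x.2 (w n) (w n).2, hgd _ _ _ _⟩) n
  have hj : Monotone j := monotone_nat_of_le_succ fun n => hg1 _ _ _ _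
  have hjw : ∀ n, w n ≤ j (n + 1) := fun n => hg2 _ _ _ _
  have key : ∀ t ∈ Set.Ioi (0 : ℝ), (⨆ i ∈ d, φ i t) ≤ ⨆ n, φ (j n).1 t := by
    intro t ht
    refine iSup₂_le fun i hi => ?_
    rw [hr i t ht]
    refine iSup₂_le fun s hs => ?_
    obtain ⟨q, hq1, hq2⟩ := exists_rat_btwn (Set.mem_Ioi.1 hs)
    calc φ i s ≤ φ i q := ha i hq2.le
      _ ≤ ⨆ i ∈ d, φ i q := le_iSup₂ (f := fun i (_ : i ∈ d) => φ i (q : ℝ)) i hi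
      _ = ⨆ n, φ (u q n) q := (hu' q).symm
      _ ≤ ⨆ n, φ (j n).1 t := by
        refine iSup_le fun n => ?_
        obtain ⟨m, hm'⟩ := he (q, n)
        have : (w m).1 = u q n := by simp [w, hm']
        refine le_trans ?_ (le_iSup _ (m + 1))
        calc φ (u q n) q ≤ φ (u q n) t := ha _ hq1.le
          _ = φ (w m).1 t := by rw [this]
          _ ≤ φ (j (m + 1)).1 t := hm (hjw m) t
  calc _ ≤ ∫⁻ t in Set.Ioi (0 : ℝ), ⨆ n, φ (j n).1 t :=
        MeasureTheory.setLIntegral_mono' measurableSet_Ioi key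
    _ = ⨆ n, ∫⁻ t in Set.Ioi (0 : ℝ), φ (j n).1 t :=
        MeasureTheory.lintegral_iSup (fun n => (ha _).measurable) fun a b h => hm (hj h)
    _ ≤ _ := iSup_le fun n => le_iSup₂ (f := fun i (_ : i ∈ d) =>
        ∫⁻ t in Set.Ioi (0 : ℝ), φ i t) _ (j n).2

theorem lintegral_indicator_lt (c : ℝ≥0∞) :
    ∫⁻ t in Set.Ioi (0 : ℝ), (if ENNReal.ofReal t < c then (1 : ℝ≥0∞) else 0) = c := by
  have h1 : MeasurableSet {t : ℝ | ENNReal.ofReal t < c} :=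
    measurableSet_lt (by fun_prop) measurable_const
  have h2 : (fun t : ℝ => if ENNReal.ofReal t < c then (1 : ℝ≥0∞) else 0)
      = Set.indicator {t : ℝ | ENNReal.ofReal t < c} (fun _ => 1) := by
    ext t; simp [Set.indicator_apply]
  rw [h2, MeasureTheory.lintegral_indicator_const h1, one_mul,
    MeasureTheory.Measure.restrict_apply h1]
  by_cases hc : c = ⊤
  · subst hc
    have : {t : ℝ | ENNReal.ofReal t < ⊤} ∩ Set.Ioi 0 = Set.Ioi 0 := by ext; simp
    rw [this]; simp
  · have : {t : ℝ | ENNReal.ofReal t < c} ∩ Set.Ioi 0 = Set.Ioo 0 c.toReal := by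
      ext t
      simp only [Set.mem_inter_iff, Set.mem_ofPred_eq, Set.mem_Ioi, Set.mem_Ioo]
      constructor
      · rintro ⟨h, h0⟩
        exact ⟨h0, (ENNReal.ofReal_lt_iff_lt_toReal h0.le hc).1 h⟩
      · rintro ⟨h0, h⟩
        exact ⟨(ENNReal.ofReal_lt_iff_lt_toReal h0.le hc).2 h, h0⟩
    rw [this, Real.volume_Ioo, sub_zero, ENNReal.ofReal_toReal hc]

namespace Valuation
variable {X Y : Type*} [TopologicalSpace X] [TopologicalSpace Y]

/-- The open superlevel sets of `h`. -/
def superlevel (h : X → ℝ≥0∞) (t : ℝ) : Opens X := Opens.interior {x | ENNReal.ofReal t < h x}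

theorem mem_superlevel {h : X → ℝ≥0∞} (hh : LowerSemicontinuous h) {t : ℝ} {x : X} :
    x ∈ superlevel h t ↔ ENNReal.ofReal t < h x := by
  have : IsOpen {x | ENNReal.ofReal t < h x} :=
    lowerSemicontinuous_iff_isOpen_preimage.1 hh _
  simp [superlevel, Opens.mem_interior, this.interior_eq]

theorem superlevel_antitone (h : X → ℝ≥0∞) : Antitone (superlevel h) := fun _ _ hst =>
  Opens.gc.monotone_u fun _ hx => lt_of_le_of_lt (ENNReal.ofReal_le_ofReal hst) hx

theorem integral_eq (ν : Valuation X) (h : X → ℝ≥0∞) :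
    integral ν h = ∫⁻ t in Set.Ioi (0 : ℝ), ν (superlevel h t) := rfl

theorem integral_mono_left {μ ν : Valuation X} (hμν : μ ≤ ν) (h : X → ℝ≥0∞) :
    integral μ h ≤ integral ν h := MeasureTheory.lintegral_mono fun _ => hμν _

theorem integral_mono_right (ν : Valuation X) {g h : X → ℝ≥0∞} (hgh : g ≤ h) :
    integral ν g ≤ integral ν h := MeasureTheory.lintegral_mono fun _ =>
  ν.mono (Opens.gc.monotone_u fun x hx => lt_of_lt_of_le hx (hgh x))

theorem superlevel_right (ν : Valuation X) {h : X → ℝ≥0∞} (hh : LowerSemicontinuous h) (t : ℝ) :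
    ν (superlevel h t) = ⨆ s ∈ Set.Ioi t, ν (superlevel h s) := by
  have hl : IsLUB (superlevel h '' Set.Ioi t) (superlevel h t) := by
    constructor
    · rintro _ ⟨s, hs, rfl⟩
      exact superlevel_antitone h (le_of_lt hs)
    · intro V hV x hx
      rw [mem_superlevel hh] at hx
      have : ∃ s > t, ENNReal.ofReal s < h x := by
        obtain ⟨r, hr1, hr2⟩ := ENNReal.lt_iff_exists_nnreal_btwn.1 hx
        by_cases ht : 0 ≤ t
        · refine ⟨r, ?_, by simpa using hr2⟩
          have := (ENNReal.ofReal_lt_iff_lt_toReal ht (by simp)).1 hr1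
          simpa using this
        · refine ⟨0, lt_of_not_ge ht, ?_⟩
          simpa using lt_of_le_of_lt (zero_le) hx
      obtain ⟨s, hs, hs'⟩ := this
      exact hV ⟨s, hs, rfl⟩ ((mem_superlevel hh).2 hs')
  rw [ScottContinuous.apply_eq ν.continuous (Set.Nonempty.image _ ⟨t + 1, by simp⟩) ?_ hl, iSup_image]
  rintro _ ⟨a, ha, rfl⟩ _ ⟨b, hb, rfl⟩
  exact ⟨_, ⟨min a b, Set.mem_Ioi.2 (lt_min ha hb), rfl⟩, superlevel_antitone h (min_le_left _ _),
    superlevel_antitone h (min_le_right _ _)⟩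

theorem integral_biSup_left {d : Set (Valuation X)} (hd : d.Nonempty)
    (hdir : DirectedOn (· ≤ ·) d) {ν : Valuation X} (hν : IsLUB d ν) {h : X → ℝ≥0∞}
    (hh : LowerSemicontinuous h) : integral ν h = ⨆ μ ∈ d, integral μ h := by
  have h1 := (isLUB_iff hdir).1 hν
  simp only [integral_eq, h1]
  exact lintegral_biSup_antitone hd hdir (fun μ t => μ (superlevel h t))
    (fun μ μ' hμ t => hμ _) (fun μ s t hst => μ.mono (superlevel_antitone h hst))
    (fun μ t _ => superlevel_right μ hh t)

open Classical in
theorem dirac_superlevel {h : X → ℝ≥0∞} (hh : LowerSemicontinuous h) (x : X) (t : ℝ) :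
    dirac x (superlevel h t) = if ENNReal.ofReal t < h x then 1 else 0 := by
  rw [dirac_apply]
  simp only [mem_superlevel hh]

theorem integral_dirac {h : X → ℝ≥0∞} (hh : LowerSemicontinuous h) (x : X) :
    integral (dirac x) h = h x := by
  classical
  simp only [integral_eq, dirac_superlevel hh]
  exact lintegral_indicator_lt _

theorem measurable_superlevel (ν : Valuation X) (h : X → ℝ≥0∞) :
    Measurable fun t => ν (superlevel h t) :=
  Antitone.measurable fun _ _ hst => ν.mono (superlevel_antitone h hst)

@[simp] theorem integral_zero_left (h : X → ℝ≥0∞) : integral (0 : Valuation X) h = 0 := by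
  simp [integral_eq]

theorem integral_add_left (μ ν : Valuation X) (h : X → ℝ≥0∞) :
    integral (μ + ν) h = integral μ h + integral ν h := by
  simp only [integral_eq, add_apply]
  exact MeasureTheory.lintegral_add_left (measurable_superlevel _ _) _

theorem integral_smul_left (r : ℝ≥0∞) (ν : Valuation X) (h : X → ℝ≥0∞) :
    integral (r • ν) h = r * integral ν h := by
  simp only [integral_eq, smul_apply]
  exact MeasureTheory.lintegral_const_mul _ (measurable_superlevel _ _)

@[simp] theorem integral_zero_right (ν : Valuation X) : integral ν (fun _ => 0) = 0 := by
  have : ∀ t, superlevel (fun _ : X => (0 : ℝ≥0∞)) t = ⊥ := by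
    intro t; ext x; simp [superlevel]
  simp [integral_eq, this, strict]

/-! ### Minimal valuations -/

/-- A simple valuation is a finite linear combination of Dirac valuations with coefficients in
the (finite) nonnegative reals. -/
def IsSimple (ν : Valuation X) : Prop :=
  ∃ (n : ℕ) (r : Fin n → ℝ≥0) (x : Fin n → X), ∀ U, ν U = ∑ i, (r i : ℝ≥0∞) * dirac (x i) U

/-- The minimal valuations: the smallest set of continuous valuations that contains the simple
valuations and is closed under suprema of directed sets. -/
inductive IsMinimal : Valuation X → Prop
  | simple (ν : Valuation X) (h : IsSimple ν) : IsMinimal ν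
  | dirSup (d : Set (Valuation X)) (hne : d.Nonempty) (hd : DirectedOn (· ≤ ·) d)
      (hmin : ∀ μ ∈ d, IsMinimal μ) (ν : Valuation X) (hν : IsLUB d ν) : IsMinimal ν

theorem isSimple_zero : IsSimple (0 : Valuation X) := ⟨0, Fin.elim0, Fin.elim0, fun U => by simp⟩

theorem isSimple_dirac (x : X) : IsSimple (dirac x) := ⟨1, fun _ => 1, fun _ => x, fun U => by simp⟩

theorem IsSimple.add {μ ν : Valuation X} (hμ : IsSimple μ) (hν : IsSimple ν) :
    IsSimple (μ + ν) := by
  obtain ⟨n, r, x, h⟩ := hμ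
  obtain ⟨m, s, y, h'⟩ := hν
  refine ⟨n + m, Fin.append r s, Fin.append x y, fun U => ?_⟩
  simp [h, h', Fin.sum_univ_add]

theorem IsSimple.smul {ν : Valuation X} (r : ℝ≥0) (hν : IsSimple ν) :
    IsSimple ((r : ℝ≥0∞) • ν) := by
  obtain ⟨n, s, y, h'⟩ := hν
  refine ⟨n, fun i => r * s i, y, fun U => ?_⟩
  simp [h', Finset.mul_sum, mul_assoc]

/-- Simple valuations are generated by zero and sums with scaled Dirac valuations. -/
theorem IsSimple.induction {P : Valuation X → Prop} (h0 : P 0)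
    (h1 : ∀ (μ : Valuation X) (r : ℝ≥0) (x : X), P μ → P (μ + (r : ℝ≥0∞) • dirac x))
    {ν : Valuation X} (hν : IsSimple ν) : P ν := by
  obtain ⟨n, r, x, h⟩ := hν
  induction n generalizing ν with
  | zero =>
    have : ν = 0 := by ext U; simp [h]
    rwa [this]
  | succ n ih =>
    let μ : ∀ n (r : Fin n → ℝ≥0) (x : Fin n → X), Valuation X := fun n => 
      Nat.rec (fun _ _ => 0) (fun n f r x => f (fun i => r i.castSucc) (fun i => x i.castSucc)
        + (r (Fin.last n) : ℝ≥0∞) • dirac (x (Fin.last n))) n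
    have hμ : ∀ n r x U, μ n r x U = ∑ i, (r i : ℝ≥0∞) * dirac (x i) U := by
      intro n
      induction n with
      | zero => intro r x U; simp [μ]
      | succ n ih =>
        intro r x U
        rw [Fin.sum_univ_castSucc, ← ih]
        rfl
    have : ν = μ n (fun i => r i.castSucc) (fun i => x i.castSucc)
        + (r (Fin.last n) : ℝ≥0∞) • dirac (x (Fin.last n)) := by
      ext U
      rw [h, Fin.sum_univ_castSucc, add_apply, hμ]
      rfl
    rw [this]
    exact h1 _ _ _ (ih _ _ (hμ n _ _))

theorem isMinimal_zero : IsMinimal (0 : Valuation X) := .simple _ isSimple_zero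

theorem isMinimal_dirac (x : X) : IsMinimal (dirac x) := .simple _ (isSimple_dirac x)

/-- Scott-continuous maps preserve minimality as soon as they preserve it on simple valuations. -/
theorem IsMinimal.map_of_scott {F : Valuation X → Valuation Y} (hF : ScottContinuous F)
    (hs : ∀ ν, IsSimple ν → IsMinimal (F ν)) {ν : Valuation X} (hν : IsMinimal ν) :
    IsMinimal (F ν) := by
  induction hν with
  | simple ν h => exact hs ν h
  | dirSup d hne hd hmin ν hν ih =>
    refine .dirSup (F '' d) (hne.image _) ?_ ?_ _ (hF hne hd hν)
    · rintro _ ⟨a, ha, rfl⟩ _ ⟨b, hb, rfl⟩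
      obtain ⟨c, hc, h1, h2⟩ := hd a ha b hb
      exact ⟨_, ⟨c, hc, rfl⟩, hF.monotone h1, hF.monotone h2⟩
    · rintro _ ⟨a, ha, rfl⟩
      exact ih a ha

/-- Scott continuity into valuations is pointwise. -/
theorem scottContinuous_iff {A : Type*} [Preorder A] {F : A → Valuation X} :
    ScottContinuous F ↔ ∀ U, ScottContinuous fun a => F a U := by
  constructor
  · intro hF U
    refine scottContinuous_ennreal (fun a b h => hF.monotone h U) fun d hne hd a ha => ?_
    have h1 : DirectedOn (· ≤ ·) (F '' d) := by
      rintro _ ⟨a, ha, rfl⟩ _ ⟨b, hb, rfl⟩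
      obtain ⟨c, hc, h1, h2⟩ := hd a ha b hb
      exact ⟨_, ⟨c, hc, rfl⟩, hF.monotone h1, hF.monotone h2⟩
    rw [(isLUB_iff h1).1 (hF hne hd ha) U, iSup_image]
  · intro h d hne hd a ha
    refine ⟨?_, fun ν hν U => ?_⟩
    · rintro _ ⟨b, hb, rfl⟩ U
      exact (h U).monotone (ha.1 hb)
    · rw [ScottContinuous.apply_eq (h U) hne hd ha]
      exact iSup₂_le fun b hb => hν ⟨b, hb, rfl⟩ U

theorem scottContinuous_eval (U : Opens X) : ScottContinuous fun ν : Valuation X => ν U :=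
  scottContinuous_iff.1 ScottContinuous.id U

theorem scottContinuous_add_const {A : Type*} [Preorder A] {f : A → ℝ≥0∞} (hf : ScottContinuous f)
    (c : ℝ≥0∞) : ScottContinuous fun a => f a + c := by
  refine scottContinuous_ennreal (fun a b h => by gcongr; exact hf.monotone h) ?_
  intro d hne hd a ha
  rw [ScottContinuous.apply_eq hf hne hd ha]
  exact (ENNReal.biSup_add hne _).le

theorem scottContinuous_const_mul {A : Type*} [Preorder A] {f : A → ℝ≥0∞} (hf : ScottContinuous f)
    (c : ℝ≥0∞) : ScottContinuous fun a => c * f a := by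
  refine scottContinuous_ennreal (fun a b h => by gcongr; exact hf.monotone h) ?_
  intro d hne hd a ha
  rw [ScottContinuous.apply_eq hf hne hd ha]
  simp [ENNReal.mul_iSup]

theorem IsMinimal.add {μ ν : Valuation X} (hμ : IsMinimal μ) (hν : IsMinimal ν) :
    IsMinimal (μ + ν) := by
  have h1 : ∀ ν : Valuation X, ScottContinuous fun μ : Valuation X => μ + ν := fun ν =>
    scottContinuous_iff.2 fun U => scottContinuous_add_const (scottContinuous_eval U) _
  have h2 : ∀ μ : Valuation X, ScottContinuous fun ν : Valuation X => μ + ν := fun μ =>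
    scottContinuous_iff.2 fun U => by
      simpa [add_comm] using scottContinuous_add_const (scottContinuous_eval U) (μ U)
  exact IsMinimal.map_of_scott (h1 ν)
    (fun μ hμ => IsMinimal.map_of_scott (h2 μ) (fun ν hν => .simple _ (hμ.add hν)) hν) hμ

theorem IsMinimal.smul {ν : Valuation X} (r : ℝ≥0) (hν : IsMinimal ν) :
    IsMinimal ((r : ℝ≥0∞) • ν) :=
  IsMinimal.map_of_scott (F := fun ν => (r : ℝ≥0∞) • ν)
    (scottContinuous_iff.2 fun U => scottContinuous_const_mul (scottContinuous_eval U) _)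
    (fun _ h => .simple _ (h.smul r)) hν

theorem isMinimal_smul_dirac (r : ℝ≥0∞) (x : X) : IsMinimal (r • dirac x) := by
  by_cases hr : r = ⊤
  · subst hr
    refine .dirSup (Set.range fun n : ℕ => (n : ℝ≥0∞) • dirac x) ⟨_, 0, rfl⟩ ?_ ?_ _ ?_
    · rintro _ ⟨a, rfl⟩ _ ⟨b, rfl⟩
      exact ⟨_, ⟨max a b, rfl⟩, fun U => by
        simp only [smul_apply]; gcongr; simp, fun U => by simp only [smul_apply]; gcongr; simp⟩
    · rintro _ ⟨n, rfl⟩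
      simpa using (isMinimal_dirac x).smul (n : ℝ≥0)
    · constructor
      · rintro _ ⟨n, rfl⟩ U
        simp only [smul_apply]; gcongr; exact le_top
      · intro ν hν U
        simp only [smul_apply]
        rw [← ENNReal.iSup_natCast, ENNReal.iSup_mul]
        exact iSup_le fun n => hν ⟨n, rfl⟩ U
  · lift r to ℝ≥0 using hr
    exact (isMinimal_dirac x).smul r

theorem exists_sum {ι : Type*} (s : Finset ι) (r : ι → ℝ≥0∞) (x : ι → X) :
    ∃ ν : Valuation X, ∀ U, ν U = ∑ i ∈ s, r i * dirac (x i) U := by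
  classical
  induction s using Finset.induction_on with
  | empty => exact ⟨0, by simp⟩
  | insert i s hi ih =>
    obtain ⟨μ, hμ⟩ := ih
    exact ⟨r i • dirac (x i) + μ, fun U => by simp [hμ, Finset.sum_insert hi]⟩

theorem isMinimal_sum {ι : Type*} (s : Finset ι) (r : ι → ℝ≥0∞) (x : ι → X) (ν : Valuation X)
    (h : ∀ U, ν U = ∑ i ∈ s, r i * dirac (x i) U) : IsMinimal ν := by
  classical
  induction s using Finset.induction_on generalizing ν with
  | empty =>
    have : ν = 0 := by ext U; simp [h]
    rw [this]; exact isMinimal_zero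
  | insert i s hi ih =>
    obtain ⟨μ, hμ⟩ := exists_sum s r x
    have : ν = r i • dirac (x i) + μ := by
      ext U; simp [h, hμ, Finset.sum_insert hi]
    rw [this]
    exact (isMinimal_smul_dirac _ _).add (ih μ hμ)

/-! ### Linearity and continuity of the integral against minimal valuations -/

theorem IsMinimal.integral_add {ν : Valuation X} (hν : IsMinimal ν) {g h : X → ℝ≥0∞}
    (hg : LowerSemicontinuous g) (hh : LowerSemicontinuous h) :
    integral ν (fun x => g x + h x) = integral ν g + integral ν h := by
  induction hν with
  | simple ν hν =>
    refine hν.induction (P := fun ν =>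
      integral ν (fun x => g x + h x) = integral ν g + integral ν h) (by simp) ?_
    intro μ r x ih
    simp only [integral_add_left, integral_smul_left, ih, integral_dirac hg, integral_dirac hh,
      integral_dirac (hg.add hh)]
    ring
  | dirSup d hne hd hmin ν hν ih =>
    rw [integral_biSup_left hne hd hν (hg.add hh), integral_biSup_left hne hd hν hg,
      integral_biSup_left hne hd hν hh,
      biSup_add_directed hd (fun _ _ h => integral_mono_left h _)
        (fun _ _ h => integral_mono_left h _)]
    exact biSup_congr fun μ hμ => ih μ hμ

theorem IsMinimal.integral_biSup {ν : Valuation X} (hν : IsMinimal ν) {A : Type*} [Preorder A]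
    {h : A → X → ℝ≥0∞} (hm : Monotone h) (hh : ∀ a, LowerSemicontinuous (h a)) {d : Set A}
    (hd : DirectedOn (· ≤ ·) d) {g : X → ℝ≥0∞} (hg : LowerSemicontinuous g)
    (hsup : ∀ x, g x = ⨆ a ∈ d, h a x) :
    integral ν g = ⨆ a ∈ d, integral ν (h a) := by
  induction hν with
  | simple ν hν =>
    refine hν.induction (P := fun ν => integral ν g = ⨆ a ∈ d, integral ν (h a)) ?_ ?_
    · simp
    intro μ r x ih
    simp only [integral_add_left, integral_smul_left, ih, integral_dirac hg, integral_dirac (hh _)]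
    rw [hsup x, ← biSup_add_directed hd (fun _ _ h => integral_mono_right _ (hm h))
      (g := fun a => (r : ℝ≥0∞) * h a x) (fun _ _ h => by simp only; gcongr; exact hm h x)]
    simp [ENNReal.mul_iSup]
  | dirSup d' hne' hd' hmin ν hν ih =>
    rw [integral_biSup_left hne' hd' hν hg]
    simp only [integral_biSup_left hne' hd' hν (hh _)]
    rw [iSup₂_comm]
    exact biSup_congr fun μ hμ => ih μ hμ

end Valuation

/-! ### Constructions on dcpos -/

/-- Every nonempty directed subset has a least upper bound, i.e. the poset is a dcpo. -/
def DirComplete (P : Type*) [PartialOrder P] : Prop :=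
  ∀ d : Set P, d.Nonempty → DirectedOn (· ≤ ·) d → ∃ a, IsLUB d a

theorem withBot_lub {P : Type*} [PartialOrder P] {d : Set (WithBot P)}
    (hdir : DirectedOn (· ≤ ·) d) (h : {p : P | (p : WithBot P) ∈ d}.Nonempty) :
    DirectedOn (· ≤ ·) {p : P | (p : WithBot P) ∈ d} ∧
    ∀ a : P, IsLUB {p : P | (p : WithBot P) ∈ d} a → IsLUB d (a : WithBot P) := by
  constructor
  · intro p hp q hq
    obtain ⟨r, hr, h1, h2⟩ := hdir _ hp _ hq
    induction r with
    | bot => simp at h1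
    | coe r => exact ⟨r, hr, WithBot.coe_le_coe.1 h1, WithBot.coe_le_coe.1 h2⟩
  · intro a ha
    constructor
    · intro x hx
      induction x with
      | bot => simp
      | coe x => exact WithBot.coe_le_coe.2 (ha.1 hx)
    · intro b hb
      obtain ⟨p, hp⟩ := h
      induction b with
      | bot => simpa using hb hp
      | coe b => exact WithBot.coe_le_coe.2 (ha.2 fun q hq => WithBot.coe_le_coe.1 (hb hq))

open Classical in
/-- The lift of a dcpo. -/
@[reducible] def liftCPO {P : Type*} [PartialOrder P] (hP : DirComplete P) :
    CompletePartialOrder (WithBot P) where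
  sSup d := if h : {p : P | (p : WithBot P) ∈ d}.Nonempty ∧
      DirectedOn (· ≤ ·) {p : P | (p : WithBot P) ∈ d}
    then ((hP _ h.1 h.2).choose : WithBot P) else ⊥
  bot := ⊥
  bot_le := fun _ => bot_le
  lubOfDirected d hdir := by
    by_cases h : {p : P | (p : WithBot P) ∈ d}.Nonempty
    · have h2 := withBot_lub hdir h
      rw [dif_pos ⟨h, h2.1⟩]
      exact h2.2 _ (hP _ h h2.1).choose_spec
    · rw [dif_neg (fun h' => h h'.1)]
      refine ⟨fun x hx => ?_, fun _ _ => bot_le⟩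
      induction x with
      | bot => exact le_rfl
      | coe x => exact absurd ⟨x, hx⟩ h

/-- Strict maps out of a lift are Scott-continuous as soon as they are so on the original dcpo. -/
theorem scottContinuous_withBot {P Z : Type*} [PartialOrder P] [Preorder Z] {f : WithBot P → Z}
    (hP : DirComplete P) (hbot : ∀ p : P, f ⊥ ≤ f p)
    (hf : ScottContinuous fun p : P => f p) : ScottContinuous f := by
  intro d hne hdir a ha
  have hb : ∀ x, f ⊥ ≤ f x := by
    intro x; induction x with
    | bot => exact le_rfl
    | coe p => exact hbot p
  by_cases h : {p : P | (p : WithBot P) ∈ d}.Nonempty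
  · have h2 := withBot_lub hdir h
    obtain ⟨a', ha'⟩ := hP _ h h2.1
    have haa := ha.unique (h2.2 a' ha')
    subst haa
    have h3 := hf h h2.1 ha'
    constructor
    · rintro _ ⟨x, hx, rfl⟩
      induction x with
      | bot => exact hb _
      | coe p => exact h3.1 ⟨p, hx, rfl⟩
    · intro z hz
      refine h3.2 ?_
      rintro _ ⟨p, hp, rfl⟩
      exact hz ⟨_, hp, rfl⟩
  · have h3 : d = {⊥} := by
      ext x
      induction x with
      | bot =>
        obtain ⟨y, hy⟩ := hne
        induction y with
        | bot => simpa using hy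
        | coe y => exact absurd ⟨y, hy⟩ h
      | coe x => exact ⟨fun hx => absurd ⟨x, hx⟩ h, fun hx => by simp at hx⟩
    subst h3
    have : a = ⊥ := ha.unique isLUB_singleton
    subst this
    simp

theorem scottContinuous_coe {P : Type*} [PartialOrder P] :
    ScottContinuous ((↑) : P → WithBot P) := by
  intro d hne hdir a ha
  constructor
  · rintro _ ⟨p, hp, rfl⟩
    exact WithBot.coe_le_coe.2 (ha.1 hp)
  · intro b hb
    obtain ⟨p, hp⟩ := hne
    induction b with
    | bot => simpa using hb ⟨p, hp, rfl⟩
    | coe b => exact WithBot.coe_le_coe.2 (ha.2 fun q hq => WithBot.coe_le_coe.1 (hb ⟨q, hq, rfl⟩))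

/-- A set with the discrete order. -/
structure Disc (A : Type) where
  val : A

instance (A : Type) : PartialOrder (Disc A) where
  le a b := a = b
  le_refl _ := rfl
  le_trans _ _ _ h h' := h.trans h'
  le_antisymm _ _ h _ := h

theorem dirComplete_disc (A : Type) : DirComplete (Disc A) := by
  rintro d ⟨a, ha⟩ hdir
  refine ⟨a, fun b hb => ?_, fun c hc => hc ha⟩
  obtain ⟨c, hc, h1, h2⟩ := hdir a ha b hb
  exact h2.trans h1.symm

/-- The dcpo of closed bounded nonempty real intervals, ordered by reverse inclusion. -/
abbrev IR : Type := (NonemptyInterval ℝ)ᵒᵈ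

namespace IR

/-- The interval `[a, b]`. -/
def mk (a b : ℝ) (h : a ≤ b) : IR := OrderDual.toDual ⟨(a, b), h⟩

/-- The left endpoint. -/
def lo (x : IR) : ℝ := (OrderDual.ofDual x).fst

/-- The right endpoint. -/
def hi (x : IR) : ℝ := (OrderDual.ofDual x).snd

theorem le_iff {x y : IR} : x ≤ y ↔ x.lo ≤ y.lo ∧ y.hi ≤ x.hi := Iff.rfl

theorem lo_le_hi (x : IR) : x.lo ≤ x.hi := (OrderDual.ofDual x).fst_le_snd

theorem dir_lo_le_hi {d : Set IR} (hdir : DirectedOn (· ≤ ·) d) {x y : IR} (hx : x ∈ d)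
    (hy : y ∈ d) : x.lo ≤ y.hi := by
  obtain ⟨z, -, h1, h2⟩ := hdir x hx y hy
  exact ((le_iff.1 h1).1.trans z.lo_le_hi).trans (le_iff.1 h2).2

theorem exists_lub {d : Set IR} (hne : d.Nonempty) (hdir : DirectedOn (· ≤ ·) d) :
    ∃ a : IR, IsLUB d a ∧ a.lo = sSup (lo '' d) ∧ a.hi = sInf (hi '' d) := by
  have hba : BddAbove (lo '' d) := by
    obtain ⟨y, hy⟩ := hne
    exact ⟨y.hi, by rintro _ ⟨x, hx, rfl⟩; exact dir_lo_le_hi hdir hx hy⟩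
  have hbb : BddBelow (hi '' d) := by
    obtain ⟨y, hy⟩ := hne
    exact ⟨y.lo, by rintro _ ⟨x, hx, rfl⟩; exact dir_lo_le_hi hdir hy hx⟩
  have h : sSup (lo '' d) ≤ sInf (hi '' d) := by
    refine csSup_le (hne.image _) ?_
    rintro _ ⟨x, hx, rfl⟩
    refine le_csInf (hne.image _) ?_
    rintro _ ⟨y, hy, rfl⟩
    exact dir_lo_le_hi hdir hx hy
  refine ⟨mk _ _ h, ⟨fun x hx => le_iff.2 ⟨le_csSup hba ⟨x, hx, rfl⟩, csInf_le hbb ⟨x, hx, rfl⟩⟩,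
    fun y hy => le_iff.2 ⟨csSup_le (hne.image _) ?_, le_csInf (hne.image _) ?_⟩⟩, rfl, rfl⟩
  · rintro _ ⟨x, hx, rfl⟩
    exact (le_iff.1 (hy hx)).1
  · rintro _ ⟨x, hx, rfl⟩
    exact (le_iff.1 (hy hx)).2

theorem dirComplete : DirComplete IR := fun _ hne hdir =>
  let ⟨a, ha, _⟩ := exists_lub hne hdir; ⟨a, ha⟩

end IR

theorem dirComplete_sum (X Y : PDcpo) : DirComplete (X ⊕ Y) := by
  rintro d ⟨x, hx⟩ hdir
  have key : ∀ {Z : PDcpo} (j : Z → X ⊕ Y) (_ : ∀ a b, j a ≤ j b ↔ a ≤ b)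
      (_ : ∀ y ∈ d, ∃ z, y = j z) (_ : ∀ z y, j z ≤ y → ∃ z', y = j z'),
      ∃ a, IsLUB d a := by
    intro Z j hj hd hup
    have h1 : DirectedOn (· ≤ ·) (j ⁻¹' d) := by
      intro a ha b hb
      obtain ⟨c, hc, h1, h2⟩ := hdir _ ha _ hb
      obtain ⟨z, rfl⟩ := hd c hc
      exact ⟨z, hc, (hj _ _).1 h1, (hj _ _).1 h2⟩
    have h2 := h1.isLUB_sSup
    refine ⟨j (sSup (j ⁻¹' d)), fun y hy => ?_, fun y hy => ?_⟩
    · obtain ⟨z, rfl⟩ := hd y hy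
      exact (hj _ _).2 (h2.1 hy)
    · obtain ⟨z0, hz0⟩ := hd x hx
      obtain ⟨z', rfl⟩ := hup z0 y (hz0 ▸ hy hx)
      refine (hj _ _).2 (h2.2 fun z hz => (hj _ _).1 (hy hz))
  cases x with
  | inl x =>
    refine key Sum.inl (fun a b => Sum.inl_le_inl_iff) ?_ ?_
    · intro y hy
      obtain ⟨c, hc, h1, h2⟩ := hdir _ hx _ hy
      cases y with
      | inl y => exact ⟨y, rfl⟩
      | inr y => cases c <;> simp at h1 h2
    · intro z y h
      cases y with
      | inl y => exact ⟨y, rfl⟩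
      | inr y => simp at h
  | inr x =>
    refine key Sum.inr (fun a b => Sum.inr_le_inr_iff) ?_ ?_
    · intro y hy
      obtain ⟨c, hc, h1, h2⟩ := hdir _ hx _ hy
      cases y with
      | inr y => exact ⟨y, rfl⟩
      | inl y => cases c <;> simp at h1 h2
    · intro z y h
      cases y with
      | inr y => exact ⟨y, rfl⟩
      | inl y => simp at h

/-- A Scott-continuous map between pointed dcpos. -/
@[ext] structure SC (X Y : PDcpo) where
  toFun : X → Y
  scott : ScottContinuous toFun

namespace SC
variable {X Y Z : PDcpo}

instance : CoeFun (SC X Y) (fun _ => X → Y) := ⟨toFun⟩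

theorem toFun_injective : Function.Injective (toFun : SC X Y → _) := by
  rintro ⟨⟩ ⟨⟩ h; congr

instance : PartialOrder (SC X Y) := PartialOrder.lift toFun toFun_injective

theorem mono (f : SC X Y) {x y : X} (h : x ≤ y) : f x ≤ f y := f.scott.monotone h

theorem directed_apply {d : Set (SC X Y)} (hd : DirectedOn (· ≤ ·) d) (x : X) :
    DirectedOn (· ≤ ·) ((fun f : SC X Y => f x) '' d) := by
  rintro _ ⟨f, hf, rfl⟩ _ ⟨g, hg, rfl⟩
  obtain ⟨k, hk, h1, h2⟩ := hd f hf g hg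
  exact ⟨_, ⟨k, hk, rfl⟩, h1 x, h2 x⟩

/-- Pointwise supremum of a directed set of Scott-continuous maps. -/
def dirSup (d : Set (SC X Y)) (hd : DirectedOn (· ≤ ·) d) : SC X Y where
  toFun x := sSup ((fun f : SC X Y => f x) '' d)
  scott := by
    intro e hne hdir a ha
    constructor
    · rintro _ ⟨x, hx, rfl⟩
      refine (directed_apply hd x).sSup_le ?_
      rintro _ ⟨f, hf, rfl⟩
      exact (f.mono (ha.1 hx)).trans ((directed_apply hd a).le_sSup ⟨f, hf, rfl⟩)
    · intro z hz
      refine (directed_apply hd a).sSup_le ?_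
      rintro _ ⟨f, hf, rfl⟩
      refine (f.scott hne hdir ha).2 ?_
      rintro _ ⟨x, hx, rfl⟩
      exact ((directed_apply hd x).le_sSup ⟨f, hf, rfl⟩).trans (hz ⟨x, hx, rfl⟩)

theorem isLUB_dirSup (d : Set (SC X Y)) (hd : DirectedOn (· ≤ ·) d) : IsLUB d (dirSup d hd) := by
  constructor
  · intro f hf x
    exact (directed_apply hd x).le_sSup ⟨f, hf, rfl⟩
  · intro g hg x
    refine (directed_apply hd x).sSup_le ?_
    rintro _ ⟨f, hf, rfl⟩
    exact hg hf x

/-- The constant map. -/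
def const (y : Y) : SC X Y := ⟨fun _ => y, ScottContinuous.const y⟩

open Classical in
instance : CompletePartialOrder (SC X Y) where
  sSup d := if hd : DirectedOn (· ≤ ·) d then dirSup d hd else const ⊥
  bot := const ⊥
  bot_le := fun _ _ => bot_le
  lubOfDirected d hd := by
    rw [dif_pos hd]
    exact isLUB_dirSup d hd

end SC

open Classical in
instance (X : PDcpo) : CompletePartialOrder {ν : Valuation X // ν.IsMinimal} where
  sSup d :=
    if hd : DirectedOn (· ≤ ·) (Subtype.val '' d) ∧ d.Nonempty then
      ⟨Valuation.dirSup (Subtype.val '' d) hd.1, .dirSup _ (hd.2.image _) hd.1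
        (by rintro _ ⟨ν, _, rfl⟩; exact ν.2) _ (Valuation.isLUB_dirSup _ _)⟩
    else ⟨0, Valuation.isMinimal_zero⟩
  bot := ⟨0, Valuation.isMinimal_zero⟩
  bot_le := fun _ _ => zero_le
  lubOfDirected d hd := by
    have h1 : DirectedOn (· ≤ ·) (Subtype.val '' d) := by
      rintro _ ⟨f, hf, rfl⟩ _ ⟨g, hg, rfl⟩
      obtain ⟨k, hk, h1, h2⟩ := hd f hf g hg
      exact ⟨_, ⟨k, hk, rfl⟩, h1, h2⟩
    by_cases h2 : d.Nonempty
    · rw [dif_pos ⟨h1, h2⟩]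
      have h3 := Valuation.isLUB_dirSup _ h1
      exact ⟨fun ν hν => h3.1 ⟨ν, hν, rfl⟩, fun μ hμ => h3.2 (by
        rintro _ ⟨ν, hν, rfl⟩; exact hμ hν)⟩
    · rw [dif_neg (fun h => h2 h.2)]
      rw [Set.not_nonempty_iff_eq_empty] at h2
      subst h2
      simp only [isLUB_empty_iff]
      exact fun _ _ => zero_le

namespace PDcpo

/-- The two-element dcpo with elements `⊥` and `*`, where `⊥ < *`. -/
def unit : PDcpo := { carrier := WithBot (Disc Unit), cpo := liftCPO (dirComplete_disc _) }

/-- The one-element dcpo. -/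
def void : PDcpo := { carrier := PUnit }

/-- The flat dcpo of integers. -/
def int : PDcpo := { carrier := WithBot (Disc ℤ), cpo := liftCPO (dirComplete_disc _) }

/-- The lifted dcpo of real intervals. -/
def real : PDcpo := { carrier := WithBot IR, cpo := liftCPO IR.dirComplete }

/-- The lifted coproduct. -/
def sum (X Y : PDcpo) : PDcpo :=
  { carrier := WithBot (X ⊕ Y), cpo := liftCPO (dirComplete_sum X Y) }

/-- The product, ordered pointwise. -/
def prod (X Y : PDcpo) : PDcpo where
  carrier := X × Y
  cpo :=
    { (inferInstance : PartialOrder (X × Y)) with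
      sSup := fun d => (sSup (Prod.fst '' d), sSup (Prod.snd '' d))
      bot := (⊥, ⊥)
      bot_le := fun _ => ⟨bot_le, bot_le⟩
      lubOfDirected := fun _ hd => isLUB_prod.2 ⟨hd.fst.isLUB_sSup, hd.snd.isLUB_sSup⟩ }

/-- The dcpo of Scott-continuous maps, ordered pointwise. -/
def fn (X Y : PDcpo) : PDcpo := { carrier := SC X Y }

/-- The dcpo of minimal valuations, with the stochastic order. -/
def dist (X : PDcpo) : PDcpo := { carrier := {ν : Valuation X // ν.IsMinimal} }

/-- The Scott-continuous map that is an element of the function dcpo. -/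
def toSC {X Y : PDcpo} (f : fn X Y) : SC X Y := f

/-- The element of the function dcpo that is a Scott-continuous map. -/
def ofSC {X Y : PDcpo} (f : SC X Y) : fn X Y := f

/-- The underlying continuous valuation of an element of the dcpo of minimal valuations. -/
def val {X : PDcpo} (ν : dist X) : Valuation X := Subtype.val (p := Valuation.IsMinimal) ν

theorem val_minimal {X : PDcpo} (ν : dist X) : (val ν).IsMinimal :=
  Subtype.property (p := Valuation.IsMinimal) ν

/-- A minimal valuation, as an element of the dcpo of minimal valuations. -/
def mkDist {X : PDcpo} (ν : Valuation X) (hν : ν.IsMinimal) : dist X :=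
  (⟨ν, hν⟩ : {ν : Valuation X // ν.IsMinimal})

@[simp] theorem val_mkDist {X : PDcpo} (ν : Valuation X) (hν : ν.IsMinimal) :
    val (mkDist ν hν) = ν := rfl

theorem val_le_iff {X : PDcpo} {μ ν : dist X} : val μ ≤ val ν ↔ μ ≤ ν := Iff.rfl

end PDcpo

/-! ### Scott-continuous operations -/

theorem scottContinuous_sc_iff {A : Type*} [Preorder A] {X Y : PDcpo} {F : A → PDcpo.fn X Y} :
    ScottContinuous F ↔ ∀ x, ScottContinuous fun a => PDcpo.toSC (F a) x := by
  constructor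
  · intro hF x d hne hd a ha
    have h1 : DirectedOn (fun f g : SC X Y => f ≤ g) (F '' d) := by
      rintro _ ⟨a, ha, rfl⟩ _ ⟨b, hb, rfl⟩
      obtain ⟨c, hc, h1, h2⟩ := hd a ha b hb
      exact ⟨_, ⟨c, hc, rfl⟩, hF.monotone h1, hF.monotone h2⟩
    have h2 : F a = PDcpo.ofSC (SC.dirSup (F '' d) h1) :=
      (hF hne hd ha).unique (SC.isLUB_dirSup _ h1)
    have h3 := (SC.directed_apply h1 x).isLUB_sSup
    have h4 : (fun a => PDcpo.toSC (F a) x) '' d = (fun f : SC X Y => f x) '' (F '' d) := by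
      ext y; constructor
      · rintro ⟨a, ha, rfl⟩
        exact ⟨_, ⟨a, ha, rfl⟩, rfl⟩
      · rintro ⟨_, ⟨a, ha, rfl⟩, rfl⟩
        exact ⟨a, ha, rfl⟩
    simp only [h2]
    rw [h4]
    exact h3
  · intro h d hne hd a ha
    refine ⟨?_, fun g hg x => ?_⟩
    · rintro _ ⟨b, hb, rfl⟩ x
      exact (h x).monotone (ha.1 hb)
    · refine (h x hne hd ha).2 ?_
      rintro _ ⟨b, hb, rfl⟩
      exact hg ⟨b, hb, rfl⟩ x

theorem val_directed {X : PDcpo} {d : Set (PDcpo.dist X)} (hd : DirectedOn (· ≤ ·) d) :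
    DirectedOn (· ≤ ·) (PDcpo.val '' d) := by
  rintro _ ⟨f, hf, rfl⟩ _ ⟨g, hg, rfl⟩
  obtain ⟨k, hk, h1, h2⟩ := hd f hf g hg
  exact ⟨_, ⟨k, hk, rfl⟩, h1, h2⟩

theorem scottContinuous_val (X : PDcpo) : ScottContinuous (PDcpo.val (X := X)) := by
  intro d hne hd a ha
  have h2 := val_directed hd
  have h3 := Valuation.isLUB_dirSup _ h2
  let s : PDcpo.dist X := PDcpo.mkDist _ (.dirSup _ (hne.image _) h2
    (by rintro _ ⟨ν, _, rfl⟩; exact PDcpo.val_minimal ν) _ h3)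
  have h4 : IsLUB d s := ⟨fun ν hν => h3.1 ⟨ν, hν, rfl⟩, fun μ hμ => h3.2 (by
    rintro _ ⟨ν, hν, rfl⟩; exact hμ hν)⟩
  rw [ha.unique h4]
  exact h3

theorem scottContinuous_dist_iff {A : Type*} [Preorder A] {X : PDcpo} {F : A → PDcpo.dist X} :
    ScottContinuous F ↔ ∀ U : Opens X, ScottContinuous fun a => PDcpo.val (F a) U := by
  have key : ScottContinuous F ↔ ScottContinuous fun a => PDcpo.val (F a) := by
    constructor
    · intro hF
      exact hF.comp (scottContinuous_val X)
    · intro hF d hne hd a ha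
      have h1 := hF hne hd ha
      refine ⟨?_, fun g hg => h1.2 ?_⟩
      · rintro _ ⟨b, hb, rfl⟩
        exact h1.1 ⟨b, hb, rfl⟩
      · rintro _ ⟨b, hb, rfl⟩
        exact hg ⟨b, hb, rfl⟩
  rw [key, Valuation.scottContinuous_iff]

namespace SC
variable {X Y Z W : PDcpo}

/-- Composition. -/
def comp (g : SC Y Z) (f : SC X Y) : SC X Z := ⟨fun x => g (f x), f.scott.comp g.scott⟩

/-- Pairing. -/
def pair (f : SC X Y) (g : SC X Z) : SC X (PDcpo.prod Y Z) :=
  ⟨fun x => (f x, g x), f.scott.prodMk g.scott⟩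

/-- First projection. -/
def fst : SC (PDcpo.prod X Y) X := ⟨Prod.fst, ScottContinuous.fst⟩

/-- Second projection. -/
def snd : SC (PDcpo.prod X Y) Y := ⟨Prod.snd, ScottContinuous.snd⟩

/-- Two-variable maps are Scott-continuous when they are separately so. -/
def mk₂ (f : X → Y → Z) (h1 : ∀ x, ScottContinuous (f x))
    (h2 : ∀ y, ScottContinuous fun x => f x y) : SC (PDcpo.prod X Y) Z :=
  ⟨fun p : X × Y => f p.1 p.2,
    ScottContinuous.fromProd (f := fun p : X × Y => f p.1 p.2) (fun x => h1 x) (fun y => h2 y)⟩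

theorem scott_left (f : SC (PDcpo.prod X Y) Z) (y : Y) :
    ScottContinuous fun x : X => f ((x, y) : X × Y) :=
  (ScottContinuous.prodMk ScottContinuous.id (ScottContinuous.const y)).comp f.scott

theorem scott_right (f : SC (PDcpo.prod X Y) Z) (x : X) :
    ScottContinuous fun y : Y => f ((x, y) : X × Y) :=
  (ScottContinuous.prodMk (ScottContinuous.const x) ScottContinuous.id).comp f.scott

/-- Currying with respect to the first argument. -/
def curry (f : SC (PDcpo.prod X Y) Z) : SC Y (PDcpo.fn X Z) :=
  ⟨fun y => PDcpo.ofSC ⟨fun x => f ((x, y) : X × Y), f.scott_left y⟩,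
    scottContinuous_sc_iff.2 fun x => f.scott_right x⟩

/-- Application. -/
def app : SC (PDcpo.prod (PDcpo.fn X Y) X) Y :=
  mk₂ (fun f x => PDcpo.toSC f x) (fun f => (PDcpo.toSC f).scott)
    (fun x => scottContinuous_sc_iff.1 ScottContinuous.id x)

theorem iterate_le_succ (f : SC X X) (n : ℕ) : f.toFun^[n] ⊥ ≤ f.toFun^[n + 1] ⊥ := by
  induction n with
  | zero => exact bot_le
  | succ n ih =>
    rw [Function.iterate_succ_apply', Function.iterate_succ_apply']
    exact f.mono ih

theorem iterate_directed (f : SC X X) :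
    DirectedOn (· ≤ ·) (Set.range fun n => f.toFun^[n] ⊥) :=
  (monotone_nat_of_le_succ f.iterate_le_succ).directed_le.directedOn_range

/-- The least fixed point of a Scott-continuous map, as the supremum of its iterates on `⊥`. -/
def lfp (f : SC X X) : X := ⨆ n, f.toFun^[n] ⊥

theorem isLUB_lfp (f : SC X X) : IsLUB (Set.range fun n => f.toFun^[n] ⊥) f.lfp :=
  f.iterate_directed.isLUB_sSup

theorem scott_iterate (n : ℕ) : ScottContinuous fun f : PDcpo.fn X X => (PDcpo.toSC f).toFun^[n] ⊥ := by
  induction n with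
  | zero => exact ScottContinuous.const _
  | succ n ih =>
    simp only [Function.iterate_succ_apply']
    exact (ScottContinuous.prodMk ScottContinuous.id ih).comp (app (X := X) (Y := X)).scott

/-- The fixed point operator. -/
def fix : SC (PDcpo.fn X X) X where
  toFun f := lfp (PDcpo.toSC f)
  scott := by
    intro d hne hdir a ha
    constructor
    · rintro _ ⟨f, hf, rfl⟩
      refine (isLUB_lfp (PDcpo.toSC f)).2 ?_
      rintro _ ⟨n, rfl⟩
      exact ((scott_iterate n).monotone (ha.1 hf)).trans ((isLUB_lfp (PDcpo.toSC a)).1 ⟨n, rfl⟩)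
    · intro z hz
      refine (isLUB_lfp (PDcpo.toSC a)).2 ?_
      rintro _ ⟨n, rfl⟩
      refine (scott_iterate n hne hdir ha).2 ?_
      rintro _ ⟨f, hf, rfl⟩
      exact ((isLUB_lfp (PDcpo.toSC f)).1 ⟨n, rfl⟩).trans (hz ⟨f, hf, rfl⟩)

/-- First injection. -/
def inl : SC X (PDcpo.sum X Y) where
  toFun x := ((Sum.inl x : X ⊕ Y) : WithBot (X ⊕ Y))
  scott := by
    refine ScottContinuous.comp (g := ((↑) : X ⊕ Y → WithBot (X ⊕ Y))) ?_ scottContinuous_coe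
    rintro d ⟨x, hx⟩ hdir a ha
    constructor
    · rintro _ ⟨p, hp, rfl⟩
      exact Sum.inl_le_inl_iff.2 (ha.1 hp)
    · rintro (b | b) hb
      · exact Sum.inl_le_inl_iff.2 (ha.2 fun q hq => Sum.inl_le_inl_iff.1 (hb ⟨q, hq, rfl⟩))
      · simpa using hb ⟨x, hx, rfl⟩

/-- Second injection. -/
def inr : SC Y (PDcpo.sum X Y) where
  toFun y := ((Sum.inr y : X ⊕ Y) : WithBot (X ⊕ Y))
  scott := by
    refine ScottContinuous.comp (g := ((↑) : X ⊕ Y → WithBot (X ⊕ Y))) ?_ scottContinuous_coe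
    rintro d ⟨x, hx⟩ hdir a ha
    constructor
    · rintro _ ⟨p, hp, rfl⟩
      exact Sum.inr_le_inr_iff.2 (ha.1 hp)
    · rintro (b | b) hb
      · simpa using hb ⟨x, hx, rfl⟩
      · exact Sum.inr_le_inr_iff.2 (ha.2 fun q hq => Sum.inr_le_inr_iff.1 (hb ⟨q, hq, rfl⟩))

/-- Case analysis. -/
def caseFun (f : SC X Z) (g : SC Y Z) : WithBot (X ⊕ Y) → Z
  | some (Sum.inl x) => f x
  | some (Sum.inr y) => g y
  | none => ⊥

theorem caseFun_scott (f : SC X Z) (g : SC Y Z) : ScottContinuous (caseFun f g) := by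
  refine scottContinuous_withBot (dirComplete_sum X Y) (fun p => bot_le) ?_
  intro d hne hdir a ha
  have hm : Monotone fun p : X ⊕ Y => caseFun f g p := by
    rintro (p | p) (q | q) hpq
    · exact f.mono (Sum.inl_le_inl_iff.1 hpq)
    · simp at hpq
    · simp at hpq
    · exact g.mono (Sum.inr_le_inr_iff.1 hpq)
  refine ⟨?_, fun z hz => ?_⟩
  · rintro _ ⟨p, hp, rfl⟩
    exact hm (ha.1 hp)
  · rcases a with a | a
    · have h1 : ∀ p ∈ d, ∃ x, p = Sum.inl x := by
        rintro (p | p) hp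
        · exact ⟨p, rfl⟩
        · simpa using ha.1 hp
      have h2 : IsLUB (Sum.inl ⁻¹' d) a := by
        refine ⟨fun x hx => Sum.inl_le_inl_iff.1 (ha.1 hx), fun b hb => ?_⟩
        refine Sum.inl_le_inl_iff.1 (ha.2 (show Sum.inl b ∈ upperBounds d from ?_))
        intro p hp
        obtain ⟨x, rfl⟩ := h1 p hp
        exact Sum.inl_le_inl_iff.2 (hb hp)
      refine (f.scott ?_ ?_ h2).2 ?_
      · obtain ⟨p, hp⟩ := hne
        obtain ⟨x, rfl⟩ := h1 p hp
        exact ⟨x, hp⟩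
      · intro x hx y hy
        obtain ⟨c, hc, h3, h4⟩ := hdir _ hx _ hy
        obtain ⟨c, rfl⟩ := h1 c hc
        exact ⟨c, hc, Sum.inl_le_inl_iff.1 h3, Sum.inl_le_inl_iff.1 h4⟩
      · rintro _ ⟨x, hx, rfl⟩
        exact hz ⟨_, hx, rfl⟩
    · have h1 : ∀ p ∈ d, ∃ x, p = Sum.inr x := by
        rintro (p | p) hp
        · simpa using ha.1 hp
        · exact ⟨p, rfl⟩
      have h2 : IsLUB (Sum.inr ⁻¹' d) a := by
        refine ⟨fun x hx => Sum.inr_le_inr_iff.1 (ha.1 hx), fun b hb => ?_⟩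
        refine Sum.inr_le_inr_iff.1 (ha.2 (show Sum.inr b ∈ upperBounds d from ?_))
        intro p hp
        obtain ⟨x, rfl⟩ := h1 p hp
        exact Sum.inr_le_inr_iff.2 (hb hp)
      refine (g.scott ?_ ?_ h2).2 ?_
      · obtain ⟨p, hp⟩ := hne
        obtain ⟨x, rfl⟩ := h1 p hp
        exact ⟨x, hp⟩
      · intro x hx y hy
        obtain ⟨c, hc, h3, h4⟩ := hdir _ hx _ hy
        obtain ⟨c, rfl⟩ := h1 c hc
        exact ⟨c, hc, Sum.inr_le_inr_iff.1 h3, Sum.inr_le_inr_iff.1 h4⟩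
      · rintro _ ⟨x, hx, rfl⟩
        exact hz ⟨_, hx, rfl⟩

/-- The semantic case construct. -/
def case : SC (PDcpo.prod (PDcpo.sum X Y) (PDcpo.prod (PDcpo.fn X Z) (PDcpo.fn Y Z))) Z :=
  mk₂ (fun m (fg : PDcpo.fn X Z × PDcpo.fn Y Z) =>
      caseFun (PDcpo.toSC fg.1) (PDcpo.toSC fg.2) m)
    (fun m => by
      rcases m with _ | (x | y)
      · exact ScottContinuous.const _
      · exact ScottContinuous.comp (g := fun f : PDcpo.fn X Z => PDcpo.toSC f x)
          ScottContinuous.fst (scottContinuous_sc_iff.1 ScottContinuous.id x)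
      · exact ScottContinuous.comp (g := fun f : PDcpo.fn Y Z => PDcpo.toSC f y)
          ScottContinuous.snd (scottContinuous_sc_iff.1 ScottContinuous.id y))
    (fun fg : PDcpo.fn X Z × PDcpo.fn Y Z =>
      caseFun_scott (PDcpo.toSC fg.1) (PDcpo.toSC fg.2))

/-- The unit of the monad of minimal valuations. -/
def ret : SC X (PDcpo.dist X) where
  toFun x := PDcpo.mkDist (Valuation.dirac x) (Valuation.isMinimal_dirac x)
  scott := by
    classical
    refine scottContinuous_dist_iff.2 fun U => scottContinuous_ennreal ?_ ?_
    · intro x y hxy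
      simp only [PDcpo.val_mkDist, Valuation.dirac_apply]
      by_cases h : x ∈ U
      · have : y ∈ U := (PDcpo.isOpen_iff.1 U.isOpen).1 hxy h
        simp [h, this]
      · simp [h]
    · intro d hne hdir a ha
      simp only [PDcpo.val_mkDist, Valuation.dirac_apply]
      by_cases h : a ∈ U
      · obtain ⟨x, hx, hxU⟩ := (PDcpo.isOpen_iff.1 U.isOpen).2 hne hdir ha h
        refine le_trans ?_ (le_iSup₂ (f := fun x (_ : x ∈ d) => if x ∈ U then (1 : ℝ≥0∞) else 0) x hx)
        have hxU' : x ∈ U := hxU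
        simp [h, hxU']
      · simp [h]

theorem lsc_dist (f : SC X (PDcpo.dist Y)) (V : Opens Y) :
    LowerSemicontinuous fun x => PDcpo.val (f x) V :=
  lsc_of_scott (scottContinuous_dist_iff.1 f.scott V)

/-- The underlying continuous valuation of the extension of `f` at a minimal valuation. -/
def daggerVal (f : SC X (PDcpo.dist Y)) (μ : Valuation X) (hμ : μ.IsMinimal) : Valuation Y where
  toFun V := μ.integral fun x => PDcpo.val (f x) V
  strict := by simp [Valuation.strict]
  modular U V := by
    rw [← hμ.integral_add (f.lsc_dist _) (f.lsc_dist _),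
      ← hμ.integral_add (f.lsc_dist _) (f.lsc_dist _)]
    simp only [Valuation.modular]
  continuous := by
    refine scottContinuous_ennreal
      (fun U V h => μ.integral_mono_right fun x => (PDcpo.val (f x)).mono h) ?_
    intro d hne hdir V hV
    refine (hμ.integral_biSup (h := fun (V : Opens Y) x => PDcpo.val (f x) V)
      (fun U V h x => (PDcpo.val (f x)).mono h) (fun V => f.lsc_dist V) hdir (f.lsc_dist V) fun x => ?_).le
    exact ScottContinuous.apply_eq (PDcpo.val (f x)).continuous hne hdir hV

theorem daggerVal_minimal (f : SC X (PDcpo.dist Y)) (μ : Valuation X) (hμ : μ.IsMinimal) :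
    (daggerVal f μ hμ).IsMinimal := by
  induction hμ with
  | simple ν hν =>
    have h := hν.induction
      (P := fun ν => ν.IsMinimal ∧ ∀ h : ν.IsMinimal, (daggerVal f ν h).IsMinimal)
      ⟨Valuation.isMinimal_zero, fun h => by
        have : daggerVal f 0 h = 0 := by ext U; simp [daggerVal]
        rw [this]; exact Valuation.isMinimal_zero⟩ ?_
    · exact h.2 _
    · rintro μ r x ⟨hμ, ih⟩
      refine ⟨hμ.add ((Valuation.isMinimal_dirac x).smul r), fun h => ?_⟩
      have : daggerVal f _ h = daggerVal f μ hμ + (r : ℝ≥0∞) • PDcpo.val (f x) := by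
        ext U
        simp [daggerVal, Valuation.integral_add_left, Valuation.integral_smul_left,
          Valuation.integral_dirac (f.lsc_dist U)]
      rw [this]
      exact (ih hμ).add ((PDcpo.val_minimal (f x)).smul r)
  | dirSup d hne hd hmin ν hν ih =>
    have hdir : DirectedOn (· ≤ ·)
        {κ | ∃ (μ : Valuation X) (h : μ ∈ d), κ = daggerVal f μ (hmin μ h)} := by
      rintro _ ⟨a, ha, rfl⟩ _ ⟨b, hb, rfl⟩
      obtain ⟨c, hc, h1, h2⟩ := hd a ha b hb
      exact ⟨_, ⟨c, hc, rfl⟩, fun U => Valuation.integral_mono_left h1 _,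
        fun U => Valuation.integral_mono_left h2 _⟩
    refine .dirSup {κ | ∃ (μ : Valuation X) (h : μ ∈ d), κ = daggerVal f μ (hmin μ h)} ?_ hdir
      ?_ _ ?_
    · obtain ⟨μ, hμ⟩ := hne
      exact ⟨_, μ, hμ, rfl⟩
    · rintro _ ⟨μ, hμ, rfl⟩
      exact ih μ hμ
    · refine (Valuation.isLUB_iff hdir).2 fun U => ?_
      have h1 : (daggerVal f ν (.dirSup d hne hd hmin ν hν)) U = ν.integral fun x => PDcpo.val (f x) U := rfl
      rw [h1, Valuation.integral_biSup_left hne hd hν (f.lsc_dist U)]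
      refine le_antisymm (iSup₂_le fun μ hμ => ?_) (iSup₂_le ?_)
      · exact le_iSup₂ (f := fun (κ : Valuation Y)
          (_ : κ ∈ {κ | ∃ (μ : Valuation X) (h : μ ∈ d), κ = daggerVal f μ (hmin μ h)}) => κ U)
          (daggerVal f μ (hmin μ hμ)) ⟨μ, hμ, rfl⟩
      · rintro _ ⟨μ, hμ, rfl⟩
        exact le_iSup₂ (f := fun (μ : Valuation X) (_ : μ ∈ d) => μ.integral fun x => PDcpo.val (f x) U) μ hμ

/-- The extension `f†` of a Kleisli map `f`, with `f†(μ)(V)` the integral of `x ↦ f(x)(V)` with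
respect to `μ`. -/
def dagger (f : SC X (PDcpo.dist Y)) (μ : PDcpo.dist X) : PDcpo.dist Y :=
  PDcpo.mkDist (daggerVal f (PDcpo.val μ) (PDcpo.val_minimal μ))
    (daggerVal_minimal f (PDcpo.val μ) (PDcpo.val_minimal μ))

/-- The extension operation as a Scott-continuous map in both arguments. -/
def bind : SC (PDcpo.prod (PDcpo.fn X (PDcpo.dist Y)) (PDcpo.dist X)) (PDcpo.dist Y) :=
  mk₂ (fun f μ => dagger (PDcpo.toSC f) μ)
    (fun f => by
      refine scottContinuous_dist_iff.2 fun V => scottContinuous_ennreal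
        (fun μ ν h => Valuation.integral_mono_left (PDcpo.val_le_iff.2 h) _) ?_
      intro d hne hdir ν hν
      have h3 := Valuation.integral_biSup_left (hne.image _) (val_directed hdir)
        (scottContinuous_val X hne hdir hν) ((PDcpo.toSC f).lsc_dist V)
      rw [iSup_image] at h3
      exact h3.le)
    (fun μ => by
      have h1 : ∀ x V, ScottContinuous fun f : PDcpo.fn X (PDcpo.dist Y) =>
          PDcpo.val (PDcpo.toSC f x) V := fun x V => scottContinuous_dist_iff.1
        ((scottContinuous_sc_iff (F := fun f : PDcpo.fn X (PDcpo.dist Y) => f)).1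
          ScottContinuous.id x) V
      refine scottContinuous_dist_iff.2 fun V => scottContinuous_ennreal
        (fun f g h => Valuation.integral_mono_right _ fun x => (h1 x V).monotone h) ?_
      intro d hne hdir f hf
      refine ((PDcpo.val_minimal μ).integral_biSup
        (h := fun (f : PDcpo.fn X (PDcpo.dist Y)) x => PDcpo.val (PDcpo.toSC f x) V)
        (fun f g h x => (h1 x V).monotone h) (fun f => (PDcpo.toSC f).lsc_dist V) hdir
        ((PDcpo.toSC f).lsc_dist V) fun x => ?_).le
      exact ScottContinuous.apply_eq (h1 x V) hne hdir hf)

end SC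

/-! ### Scores and samples -/

/-- The absolute value on lifted intervals: `0` on `⊥` and on intervals containing `0`, and the
smallest absolute value of a point of the interval otherwise. -/
def absVal : WithBot IR → ℝ≥0
  | none => 0
  | some x => Real.toNNReal (max x.lo (-x.hi))

theorem absVal_scott : ScottContinuous fun a : PDcpo.real => ((absVal a : ℝ≥0) : ℝ≥0∞) := by
  refine scottContinuous_withBot IR.dirComplete (fun _ => zero_le) ?_
  refine scottContinuous_ennreal ?_ ?_
  · intro x y hxy
    obtain ⟨h1, h2⟩ := IR.le_iff.1 hxy
    exact ENNReal.coe_le_coe.2 (Real.toNNReal_mono (max_le_max h1 (neg_le_neg h2)))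
  · intro d hne hdir a ha
    obtain ⟨b, hb, hlo, hhi⟩ := IR.exists_lub hne hdir
    have := ha.unique hb
    subst this
    change ENNReal.ofReal (max a.lo (-a.hi)) ≤ ⨆ x ∈ d, ENNReal.ofReal (max x.lo (-x.hi))
    refine le_of_forall_lt fun c hc => ?_
    lift c to ℝ≥0 using (ne_top_of_lt hc)
    rw [ENNReal.lt_ofReal_iff_toReal_lt (by simp)] at hc
    have : ∃ x ∈ d, (c : ℝ) < max x.lo (-x.hi) := by
      rcases lt_max_iff.1 hc with h | h
      · rw [hlo] at h
        obtain ⟨_, ⟨x, hx, rfl⟩, hx'⟩ := exists_lt_of_lt_csSup (hne.image _) h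
        exact ⟨x, hx, lt_max_of_lt_left hx'⟩
      · rw [hhi, lt_neg] at h
        obtain ⟨_, ⟨x, hx, rfl⟩, hx'⟩ := exists_lt_of_csInf_lt (hne.image _) h
        exact ⟨x, hx, lt_max_of_lt_right (lt_neg.1 hx')⟩
    obtain ⟨x, hx, hx'⟩ := this
    refine lt_of_lt_of_le ?_ (le_iSup₂ (f := fun (x : IR) (_ : x ∈ d) =>
      ENNReal.ofReal (max x.lo (-x.hi))) x hx)
    rw [ENNReal.lt_ofReal_iff_toReal_lt (by simp)]
    exact hx'

/-- The element `*` of the unit dcpo. -/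
def PDcpo.star : PDcpo.unit := ((⟨()⟩ : Disc Unit) : WithBot (Disc Unit))

/-- The semantics of scoring. -/
def SC.score : SC PDcpo.real (PDcpo.dist PDcpo.unit) where
  toFun a := PDcpo.mkDist (((absVal a : ℝ≥0) : ℝ≥0∞) • Valuation.dirac PDcpo.star)
    ((Valuation.isMinimal_dirac _).smul _)
  scott := scottContinuous_dist_iff.2 fun U => by
    simpa [mul_comm] using Valuation.scottContinuous_const_mul absVal_scott
      (Valuation.dirac PDcpo.star U)

/-- The embedding `a ↦ [a, a]` of the real line. -/
def PDcpo.ofReal (a : ℝ) : PDcpo.real := ((IR.mk a a le_rfl : IR) : WithBot IR)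

theorem IR.exists_nhd {U : Set PDcpo.real} (hU : IsOpen U) {a : ℝ} (ha : PDcpo.ofReal a ∈ U) :
    ∃ ε : ℝ, ∃ hε : 0 < ε, ((IR.mk (a - ε) (a + ε) (by linarith) : IR) : WithBot IR) ∈ U := by
  obtain ⟨-, hU2⟩ := PDcpo.isOpen_iff.1 hU
  let J : {ε : ℝ // 0 < ε} → IR := fun ε => IR.mk (a - ε) (a + ε) (by linarith [ε.2])
  have hJ : ∀ ε δ : {ε : ℝ // 0 < ε}, ε ≤ δ → J δ ≤ J ε := fun ε δ h =>
    IR.le_iff.2 ⟨sub_le_sub_left (show (ε : ℝ) ≤ δ from h) a,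
      add_le_add_right (show (ε : ℝ) ≤ δ from h) a⟩
  have hdir : DirectedOn (· ≤ ·) (Set.range J) := by
    rintro _ ⟨ε, rfl⟩ _ ⟨δ, rfl⟩
    exact ⟨_, ⟨⟨min ε δ, lt_min ε.2 δ.2⟩, rfl⟩, hJ _ _ (min_le_left (ε : ℝ) δ),
      hJ _ _ (min_le_right (ε : ℝ) δ)⟩
  have hlub : IsLUB (Set.range J) (IR.mk a a le_rfl) := by
    constructor
    · rintro _ ⟨ε, rfl⟩
      exact IR.le_iff.2 ⟨by simp [J, IR.mk, IR.lo, ε.2.le], by simp [J, IR.mk, IR.hi, ε.2.le]⟩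
    · intro y hy
      refine IR.le_iff.2 ⟨le_of_forall_pos_le_add fun ε hε => ?_, le_of_forall_pos_le_add fun ε hε => ?_⟩
      · have := (IR.le_iff.1 (hy ⟨⟨ε, hε⟩, rfl⟩)).1
        simp only [J, IR.mk, IR.lo, OrderDual.ofDual_toDual] at this ⊢
        linarith
      · have := (IR.le_iff.1 (hy ⟨⟨ε, hε⟩, rfl⟩)).2
        simpa only [J, IR.mk, IR.hi, OrderDual.ofDual_toDual] using this
  have hne : (Set.range J).Nonempty := ⟨_, ⟨1, one_pos⟩, rfl⟩
  obtain ⟨_, ⟨_, ⟨ε, rfl⟩, rfl⟩, h⟩ := hU2 (hne.image _) (by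
    rintro _ ⟨x, hx, rfl⟩ _ ⟨y, hy, rfl⟩
    obtain ⟨z, hz, h1, h2⟩ := hdir x hx y hy
    exact ⟨_, ⟨z, hz, rfl⟩, WithBot.coe_le_coe.2 h1, WithBot.coe_le_coe.2 h2⟩)
    (scottContinuous_coe hne hdir hlub) ha
  exact ⟨ε, ε.2, h⟩

theorem continuous_ofReal : Continuous PDcpo.ofReal := by
  rw [continuous_def]
  intro U hU
  rw [Metric.isOpen_iff]
  intro a ha
  obtain ⟨ε, hε, h⟩ := IR.exists_nhd hU ha
  refine ⟨ε, hε, fun b hb => ?_⟩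
  rw [Metric.mem_ball, Real.dist_eq, abs_lt] at hb
  refine (PDcpo.isOpen_iff.1 hU).1 (WithBot.coe_le_coe.2 (IR.le_iff.2 ⟨?_, ?_⟩)) h <;>
    simp only [IR.mk, IR.lo, IR.hi, OrderDual.ofDual_toDual] <;> linarith

/-- The valuation on lifted intervals that represents a measure on the real line, namely the image
of its restriction to the open sets under the embedding `a ↦ [a, a]`. -/
def sampleVal (μ : MeasureTheory.Measure ℝ) : Valuation PDcpo.real :=
  Valuation.map ⟨PDcpo.ofReal, continuous_ofReal⟩ (Valuation.ofMeasure μ)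

/-- The dyadic interval `[k / 2 ^ n, (k + 1) / 2 ^ n]`. -/
def dyad (n : ℕ) (k : ℤ) : PDcpo.real :=
  ((IR.mk (k / 2 ^ n) ((k + 1) / 2 ^ n) (by gcongr; linarith) : IR) : WithBot IR)

/-- The points that lie in a dyadic interval of the grid of index `n` that belongs to `U`. -/
def dyadSet (n : ℕ) (U : Set PDcpo.real) : Set ℝ :=
  {x | ∃ k ∈ Finset.Ico (-(n * 2 ^ n : ℤ)) (n * 2 ^ n),
    x ∈ Set.Ico ((k : ℝ) / 2 ^ n) ((k + 1) / 2 ^ n) ∧ dyad n k ∈ U}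

theorem dyadSet_mono {U : Set PDcpo.real} (hU : IsOpen U) : Monotone fun n => dyadSet n U := by
  refine monotone_nat_of_le_succ fun n => ?_
  rintro x ⟨k, hk, ⟨hx1, hx2⟩, hkU⟩
  have hp : (0 : ℝ) < 2 ^ n := by positivity
  have hz : (1 : ℤ) ≤ 2 ^ n := one_le_pow₀ (by norm_num)
  rw [div_le_iff₀ hp] at hx1
  rw [lt_div_iff₀ hp] at hx2
  rw [Finset.mem_Ico] at hk
  have key : ∀ k' : ℤ, (2 * k ≤ k') → (k' ≤ 2 * k + 1) → (k' : ℝ) ≤ 2 * (x * 2 ^ n) →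
      2 * (x * 2 ^ n) < k' + 1 → x ∈ dyadSet (n + 1) U := by
    intro k' h1 h2 h3 h4
    have h1' : (2 * k : ℝ) ≤ k' := by exact_mod_cast h1
    have h2' : (k' : ℝ) ≤ 2 * k + 1 := by exact_mod_cast h2
    refine ⟨k', ?_, ⟨?_, ?_⟩, ?_⟩
    · rw [Finset.mem_Ico]
      push_cast
      rw [pow_succ]
      constructor <;> nlinarith
    · rw [div_le_iff₀ (by positivity), pow_succ]; linarith
    · rw [lt_div_iff₀ (by positivity), pow_succ]; linarith
    · refine (PDcpo.isOpen_iff.1 hU).1 (WithBot.coe_le_coe.2 (IR.le_iff.2 ⟨?_, ?_⟩)) hkU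
      · simp only [IR.mk, IR.lo, OrderDual.ofDual_toDual]
        rw [div_le_div_iff₀ hp (by positivity), pow_succ]
        nlinarith
      · simp only [IR.mk, IR.hi, OrderDual.ofDual_toDual]
        rw [div_le_div_iff₀ (by positivity) hp, pow_succ]
        nlinarith
  by_cases h : 2 * (x * 2 ^ n) < 2 * k + 1
  · exact key (2 * k) le_rfl (by linarith) (by push_cast; linarith) (by push_cast; linarith)
  · exact key (2 * k + 1) (by linarith) le_rfl (by push_cast; linarith) (by push_cast; linarith)

theorem iUnion_dyadSet {U : Set PDcpo.real} (hU : IsOpen U) :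
    ⋃ n, dyadSet n U = PDcpo.ofReal ⁻¹' U := by
  ext x
  rw [Set.mem_iUnion, Set.mem_preimage]
  constructor
  · rintro ⟨n, k, hk, ⟨hx1, hx2⟩, hkU⟩
    refine (PDcpo.isOpen_iff.1 hU).1 (show dyad n k ≤ PDcpo.ofReal x from
      WithBot.coe_le_coe.2 (IR.le_iff.2 ⟨?_, ?_⟩)) hkU
    · exact hx1
    · exact hx2.le
  · intro hx
    obtain ⟨ε, hε, h⟩ := IR.exists_nhd hU hx
    obtain ⟨n1, hn1⟩ := exists_nat_gt |x|
    obtain ⟨n2, hn2⟩ := exists_pow_lt_of_lt_one hε (by norm_num : (1 / 2 : ℝ) < 1)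
    let n := max n1 n2
    have hn : |x| < n := lt_of_lt_of_le hn1 (by exact_mod_cast le_max_left _ _)
    have hp : (0 : ℝ) < 2 ^ n := by positivity
    have hn' : 1 / 2 ^ n < ε := by
      refine lt_of_le_of_lt ?_ hn2
      rw [← one_div_pow]
      exact pow_le_pow_of_le_one (by norm_num) (by norm_num) (le_max_right _ _)
    have hf1 := Int.floor_le (x * 2 ^ n)
    have hf2 := Int.lt_floor_add_one (x * 2 ^ n)
    rw [abs_lt] at hn
    have hx1 : (⌊x * 2 ^ n⌋ : ℝ) / 2 ^ n ≤ x := by rwa [div_le_iff₀ hp]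
    have hx2 : x < (⌊x * 2 ^ n⌋ + 1 : ℝ) / 2 ^ n := by rwa [lt_div_iff₀ hp]
    refine ⟨n, ⌊x * 2 ^ n⌋, ?_, ⟨hx1, hx2⟩, ?_⟩
    · rw [Finset.mem_Ico, Int.le_floor, Int.floor_lt]
      push_cast
      constructor <;> nlinarith
    · refine (PDcpo.isOpen_iff.1 hU).1 (WithBot.coe_le_coe.2 (IR.le_iff.2 ⟨?_, ?_⟩)) h
      · simp only [IR.mk, IR.lo, OrderDual.ofDual_toDual]
        rw [add_div] at hx2
        linarith
      · simp only [IR.mk, IR.hi, OrderDual.ofDual_toDual]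
        rw [add_div]
        linarith

theorem measure_dyadSet (μ : MeasureTheory.Measure ℝ) (n : ℕ) (U : Opens PDcpo.real) :
    μ (dyadSet n (U : Set PDcpo.real)) = ∑ k ∈ Finset.Ico (-(n * 2 ^ n : ℤ)) (n * 2 ^ n),
      μ (Set.Ico ((k : ℝ) / 2 ^ n) ((k + 1) / 2 ^ n)) * Valuation.dirac (dyad n k) U := by
  classical
  have h1 : dyadSet n (U : Set PDcpo.real) = ⋃ k ∈ Finset.Ico (-(n * 2 ^ n : ℤ)) (n * 2 ^ n),
      (if dyad n k ∈ U then Set.Ico ((k : ℝ) / 2 ^ n) ((k + 1) / 2 ^ n) else ∅) := by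
    ext x
    simp only [dyadSet, Set.mem_iUnion, Set.mem_ofPred_eq, exists_prop]
    refine exists_congr fun k => and_congr_right fun _ => ?_
    by_cases h : dyad n k ∈ U
    · simp [h]
    · simp [h]
  rw [h1, MeasureTheory.measure_biUnion_finset]
  · refine Finset.sum_congr rfl fun k _ => ?_
    rw [Valuation.dirac_apply]
    split_ifs <;> simp
  · intro k _ l _ hkl
    have hp : (0 : ℝ) < 2 ^ n := by positivity
    rw [Function.onFun, Set.disjoint_left]
    intro x hx hx'
    split_ifs at hx hx'
    · rw [Set.mem_Ico, div_le_iff₀ hp, lt_div_iff₀ hp] at hx hx'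
      have h1 : k < l + 1 := by exact_mod_cast hx.1.trans_lt hx'.2
      have h2 : l < k + 1 := by exact_mod_cast hx'.1.trans_lt hx.2
      omega
    all_goals simp_all
  · intro k _
    split_ifs
    · exact measurableSet_Ico
    · exact MeasurableSet.empty

theorem sampleVal_minimal (μ : MeasureTheory.Measure ℝ) : (sampleVal μ).IsMinimal := by
  choose ν hν using fun n : ℕ => Valuation.exists_sum
    (Finset.Ico (-(n * 2 ^ n : ℤ)) (n * 2 ^ n))
    (fun k => μ (Set.Ico ((k : ℝ) / 2 ^ n) ((k + 1) / 2 ^ n))) (dyad n)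
  have hν' : ∀ n U, ν n U = μ (dyadSet n (U : Set PDcpo.real)) := fun n U => by
    rw [hν, measure_dyadSet]
  have hm : Monotone ν := fun a b hab U => by
    change ν a U ≤ ν b U
    rw [hν', hν']
    exact MeasureTheory.measure_mono (dyadSet_mono U.isOpen hab)
  refine .dirSup (Set.range ν) ⟨_, 0, rfl⟩ hm.directed_le.directedOn_range ?_ _ ?_
  · rintro _ ⟨n, rfl⟩
    exact Valuation.isMinimal_sum _ _ _ _ (hν n)
  · refine (Valuation.isLUB_iff hm.directed_le.directedOn_range).2 fun U => ?_
    rw [iSup_range]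
    simp only [hν']
    rw [← (dyadSet_mono U.isOpen).measure_iUnion, iUnion_dyadSet U.isOpen]
    rfl

/-- The semantics of sampling. -/
def PDcpo.sample (μ : MeasureTheory.Measure ℝ) : PDcpo.dist PDcpo.real :=
  PDcpo.mkDist (sampleVal μ) (sampleVal_minimal μ)

/-! ### Types and their semantics -/

/-- The types of ISPCF. -/
inductive Ty : Type
  | unit
  | void
  | int
  | real
  | sum (σ τ : Ty)
  | prod (σ τ : Ty)
  | arr (σ τ : Ty)
  | dist (τ : Ty)

namespace Ty

/-- The denotational semantics of types. -/
def den : Ty → PDcpo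
  | unit => PDcpo.unit
  | void => PDcpo.void
  | int => PDcpo.int
  | real => PDcpo.real
  | sum σ τ => PDcpo.sum σ.den τ.den
  | prod σ τ => PDcpo.prod σ.den τ.den
  | arr σ τ => PDcpo.fn σ.den τ.den
  | dist τ => PDcpo.dist τ.den

/-- Basic types. -/
def IsBasic : Ty → Prop
  | unit | void | int | real => True
  | _ => False

/-- Observable types: those that contain neither function types nor distribution types. -/
def IsObs : Ty → Prop
  | unit | void | int | real => True
  | sum σ τ => σ.IsObs ∧ τ.IsObs
  | prod σ τ => σ.IsObs ∧ τ.IsObs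
  | arr _ _ | dist _ => False

/-- First-order types `σ₁ → ⋯ → σₖ → τ`, with all `σᵢ` basic and `τ` observable. -/
inductive IsFirstOrder : Ty → Prop
  | obs {τ : Ty} (h : τ.IsObs) : IsFirstOrder τ
  | arr {σ τ : Ty} (hσ : σ.IsBasic) (hτ : IsFirstOrder τ) : IsFirstOrder (arr σ τ)

/-- The number `k` of arguments of a type `σ₁ → ⋯ → σₖ → τ`, where `τ` is not a function type. -/
def arity : Ty → ℕ
  | arr _ τ => τ.arity + 1
  | _ => 0

/-- Observable elements. (There are none at types that are not observable.) -/
def Obs : (τ : Ty) → τ.den → Prop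
  | unit, v => v ≠ ⊥
  | void, v => v ≠ ⊥
  | int, v => v ≠ ⊥
  | real, v => v ≠ ⊥
  | sum σ τ, v =>
    match (v : WithBot (σ.den ⊕ τ.den)) with
    | some (Sum.inl a) => σ.Obs a
    | some (Sum.inr b) => τ.Obs b
    | none => False
  | prod σ τ, v => σ.Obs (v : σ.den × τ.den).1 ∧ τ.Obs (v : σ.den × τ.den).2
  | arr _ _, _ => False
  | dist _, _ => False

/-- Strictly observable elements `f` of a type `σ₁ → ⋯ → σₖ → τ`, where `τ` is not a function type:
`f v₁ ⋯ vₖ` is always observable or equal to `⊥`, and it is `⊥` if some `vᵢ` is `⊥`. (As elements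
of function types are maps, the latter says that `f v₁ ⋯ vᵢ₋₁ ⊥` is the constant `⊥` map.) -/
def StrictObs : (τ : Ty) → τ.den → Prop
  | arr _ τ, f => PDcpo.toSC f ⊥ = ⊥ ∧ ∀ v, τ.StrictObs (PDcpo.toSC f v)
  | τ, v => τ.Obs v ∨ v = ⊥

end Ty

/-! ### Terms -/

/-- A signature: a set of constants with their types and semantics, and a set of measures on the
real line that one may sample from. The constants of type `unit` and `int` for `*` and the integers,
and the constants of type `real` (one for each lifted interval) are not listed here: they are part
of the syntax of terms below. -/
structure Signature where
  Con : Type*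
  typ : Con → Ty
  typ_ne_real : ∀ c, typ c ≠ Ty.real
  sem : ∀ c, (typ c).den
  meas : Set (MeasureTheory.Measure ℝ)

/-- All constants are strictly observable first-order constants. -/
structure Signature.StrictlyObservable (S : Signature) : Prop where
  firstOrder : ∀ c, (S.typ c).IsFirstOrder
  strict : ∀ c, (S.typ c).StrictObs (S.sem c)
  basic : ∀ c, (S.typ c).IsObs → (S.typ c).IsBasic ∧ (S.typ c).Obs (S.sem c)

/-- Variables of a context, as typed de Bruijn indices. -/
inductive Var : List Ty → Ty → Type
  | zero {Γ : List Ty} {τ : Ty} : Var (τ :: Γ) τ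
  | succ {Γ : List Ty} {σ τ : Ty} (x : Var Γ τ) : Var (σ :: Γ) τ

/-- Typed generalized ISPCF terms, up to renaming of bound variables. -/
inductive Tm (S : Signature) : List Ty → Ty → Type _
  | var {Γ : List Ty} {τ : Ty} (x : Var Γ τ) : Tm S Γ τ
  | star {Γ : List Ty} : Tm S Γ Ty.unit
  | int {Γ : List Ty} (n : ℤ) : Tm S Γ Ty.int
  | real {Γ : List Ty} (a : PDcpo.real) : Tm S Γ Ty.real
  | con {Γ : List Ty} {τ : Ty} (c : S.Con) (h : S.typ c = τ) : Tm S Γ τ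
  | sample {Γ : List Ty} (μ : MeasureTheory.Measure ℝ) (h : μ ∈ S.meas) : Tm S Γ (Ty.dist Ty.real)
  | score {Γ : List Ty} (M : Tm S Γ Ty.real) : Tm S Γ (Ty.dist Ty.unit)
  | lam {Γ : List Ty} {σ τ : Ty} (M : Tm S (σ :: Γ) τ) : Tm S Γ (Ty.arr σ τ)
  | app {Γ : List Ty} {σ τ : Ty} (M : Tm S Γ (Ty.arr σ τ)) (N : Tm S Γ σ) : Tm S Γ τ
  | fix {Γ : List Ty} {σ : Ty} (M : Tm S Γ (Ty.arr σ σ)) : Tm S Γ σ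
  | ret {Γ : List Ty} {τ : Ty} (M : Tm S Γ τ) : Tm S Γ (Ty.dist τ)
  | bind {Γ : List Ty} {σ τ : Ty} (M : Tm S Γ (Ty.dist σ)) (N : Tm S (σ :: Γ) (Ty.dist τ)) :
      Tm S Γ (Ty.dist τ)
  | pair {Γ : List Ty} {σ τ : Ty} (M : Tm S Γ σ) (N : Tm S Γ τ) : Tm S Γ (Ty.prod σ τ)
  | fst {Γ : List Ty} {σ τ : Ty} (M : Tm S Γ (Ty.prod σ τ)) : Tm S Γ σ
  | snd {Γ : List Ty} {σ τ : Ty} (M : Tm S Γ (Ty.prod σ τ)) : Tm S Γ τ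
  | inl {Γ : List Ty} {σ τ : Ty} (M : Tm S Γ σ) : Tm S Γ (Ty.sum σ τ)
  | inr {Γ : List Ty} {σ τ : Ty} (M : Tm S Γ τ) : Tm S Γ (Ty.sum σ τ)
  | case {Γ : List Ty} {σ τ υ : Ty} (M : Tm S Γ (Ty.sum σ τ)) (N : Tm S Γ (Ty.arr σ υ))
      (P : Tm S Γ (Ty.arr τ υ)) : Tm S Γ υ

/-- The semantics of a context: its environments. -/
def ctxDen : List Ty → PDcpo
  | [] => PDcpo.void
  | σ :: Γ => PDcpo.prod σ.den (ctxDen Γ)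

/-- The semantics of variables. -/
def Var.den : {Γ : List Ty} → {τ : Ty} → Var Γ τ → SC (ctxDen Γ) τ.den
  | _, _, Var.zero => SC.fst
  | _, _, Var.succ x => x.den.comp SC.snd

namespace Tm
variable {S : Signature}

/-- The denotational semantics of terms. -/
def den : {Γ : List Ty} → {τ : Ty} → Tm S Γ τ → SC (ctxDen Γ) τ.den
  | _, _, var x => x.den
  | _, _, star => SC.const PDcpo.star
  | _, _, int n => SC.const ((⟨n⟩ : Disc ℤ) : WithBot (Disc ℤ))
  | _, _, real a => SC.const a
  | _, _, con c h => SC.const (h ▸ S.sem c)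
  | _, _, sample μ _ => SC.const (PDcpo.sample μ)
  | _, _, score M => SC.score.comp M.den
  | _, _, lam M => SC.curry M.den
  | _, _, app M N => SC.app.comp (M.den.pair N.den)
  | _, _, fix M => SC.fix.comp M.den
  | _, _, ret M => SC.ret.comp M.den
  | _, _, bind M N => SC.bind.comp (N.den.curry.pair M.den)
  | _, _, pair M N => M.den.pair N.den
  | _, _, fst M => SC.fst.comp M.den
  | _, _, snd M => SC.snd.comp M.den
  | _, _, inl M => SC.inl.comp M.den
  | _, _, inr M => SC.inr.comp M.den
  | _, _, case M N P => SC.case.comp (M.den.pair (N.den.pair P.den))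

/-- The semantics of closed terms. -/
def eval {τ : Ty} (M : Tm S [] τ) : τ.den := M.den PUnit.unit

/-- Extension of a renaming under a binder. -/
def liftRen {Γ Δ : List Ty} {ρ : Ty} (f : ∀ σ, Var Γ σ → Var Δ σ) :
    ∀ σ, Var (ρ :: Γ) σ → Var (ρ :: Δ) σ
  | _, Var.zero => Var.zero
  | _, Var.succ y => Var.succ (f _ y)

/-- Renaming of variables. -/
def rename : {Γ Δ : List Ty} → {τ : Ty} → (∀ σ, Var Γ σ → Var Δ σ) → Tm S Γ τ → Tm S Δ τ
  | _, _, _, f, var x => var (f _ x)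
  | _, _, _, _, star => star
  | _, _, _, _, int n => int n
  | _, _, _, _, real a => real a
  | _, _, _, _, con c h => con c h
  | _, _, _, _, sample μ h => sample μ h
  | _, _, _, f, score M => score (M.rename f)
  | _, _, _, f, lam M => lam (M.rename (liftRen f))
  | _, _, _, f, app M N => app (M.rename f) (N.rename f)
  | _, _, _, f, fix M => fix (M.rename f)
  | _, _, _, f, ret M => ret (M.rename f)
  | _, _, _, f, bind M N => bind (M.rename f) (N.rename (liftRen f))
  | _, _, _, f, pair M N => pair (M.rename f) (N.rename f)
  | _, _, _, f, fst M => fst (M.rename f)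
  | _, _, _, f, snd M => snd (M.rename f)
  | _, _, _, f, inl M => inl (M.rename f)
  | _, _, _, f, inr M => inr (M.rename f)
  | _, _, _, f, case M N P => case (M.rename f) (N.rename f) (P.rename f)

/-- Extension of a substitution under a binder. -/
def liftSubst {Γ Δ : List Ty} {ρ : Ty} (f : ∀ σ, Var Γ σ → Tm S Δ σ) :
    ∀ σ, Var (ρ :: Γ) σ → Tm S (ρ :: Δ) σ
  | _, Var.zero => var Var.zero
  | _, Var.succ y => (f _ y).rename fun _ => Var.succ

/-- Capture-avoiding parallel substitution. -/
def subst : {Γ Δ : List Ty} → {τ : Ty} → (∀ σ, Var Γ σ → Tm S Δ σ) → Tm S Γ τ → Tm S Δ τ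
  | _, _, _, f, var x => f _ x
  | _, _, _, _, star => star
  | _, _, _, _, int n => int n
  | _, _, _, _, real a => real a
  | _, _, _, _, con c h => con c h
  | _, _, _, _, sample μ h => sample μ h
  | _, _, _, f, score M => score (M.subst f)
  | _, _, _, f, lam M => lam (M.subst (liftSubst f))
  | _, _, _, f, app M N => app (M.subst f) (N.subst f)
  | _, _, _, f, fix M => fix (M.subst f)
  | _, _, _, f, ret M => ret (M.subst f)
  | _, _, _, f, bind M N => bind (M.subst f) (N.subst (liftSubst f))
  | _, _, _, f, pair M N => pair (M.subst f) (N.subst f)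
  | _, _, _, f, fst M => fst (M.subst f)
  | _, _, _, f, snd M => snd (M.subst f)
  | _, _, _, f, inl M => inl (M.subst f)
  | _, _, _, f, inr M => inr (M.subst f)
  | _, _, _, f, case M N P => case (M.subst f) (N.subst f) (P.subst f)

/-- The substitution that replaces the only variable of a context by `N`. -/
def single {ρ : Ty} (N : Tm S [] ρ) : ∀ σ, Var [ρ] σ → Tm S [] σ
  | _, Var.zero => N

/-- The substitution `M[x := N]` of a closed term for the only free variable of `M`. -/
def inst {σ τ : Ty} (M : Tm S [σ] τ) (N : Tm S [] σ) : Tm S [] τ :=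
  M.subst (single N)

/-! ### The space of configurations -/

/-- `Rel r M N` says that `M` and `N` have the same shape, i.e. are equal up to the constants of type
`real`, and that each constant of type `real` in `M` is related by `r` to the constant at the same
position in `N`. -/
inductive Rel (r : PDcpo.real → PDcpo.real → Prop) :
    {Γ : List Ty} → {τ : Ty} → Tm S Γ τ → Tm S Γ τ → Prop
  | var {Γ : List Ty} {τ : Ty} (x : Var Γ τ) : Rel r (var x) (var x)
  | star {Γ : List Ty} : Rel r (star : Tm S Γ _) star
  | int {Γ : List Ty} (n : ℤ) : Rel r (int n : Tm S Γ _) (int n)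
  | real {Γ : List Ty} {a b : PDcpo.real} (h : r a b) : Rel r (real a : Tm S Γ _) (real b)
  | con {Γ : List Ty} {τ : Ty} (c : S.Con) (h : S.typ c = τ) : Rel r (con c h : Tm S Γ τ) (con c h)
  | sample {Γ : List Ty} (μ : MeasureTheory.Measure ℝ) (h : μ ∈ S.meas) :
      Rel r (sample μ h : Tm S Γ _) (sample μ h)
  | score {Γ : List Ty} {M M' : Tm S Γ Ty.real} (h : Rel r M M') : Rel r (score M) (score M')
  | lam {Γ : List Ty} {σ τ : Ty} {M M' : Tm S (σ :: Γ) τ} (h : Rel r M M') :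
      Rel r (lam M) (lam M')
  | app {Γ : List Ty} {σ τ : Ty} {M M' : Tm S Γ (Ty.arr σ τ)} {N N' : Tm S Γ σ}
      (h : Rel r M M') (h' : Rel r N N') : Rel r (app M N) (app M' N')
  | fix {Γ : List Ty} {σ : Ty} {M M' : Tm S Γ (Ty.arr σ σ)} (h : Rel r M M') :
      Rel r (fix M) (fix M')
  | ret {Γ : List Ty} {τ : Ty} {M M' : Tm S Γ τ} (h : Rel r M M') : Rel r (ret M) (ret M')
  | bind {Γ : List Ty} {σ τ : Ty} {M M' : Tm S Γ (Ty.dist σ)} {N N' : Tm S (σ :: Γ) (Ty.dist τ)}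
      (h : Rel r M M') (h' : Rel r N N') : Rel r (bind M N) (bind M' N')
  | pair {Γ : List Ty} {σ τ : Ty} {M M' : Tm S Γ σ} {N N' : Tm S Γ τ}
      (h : Rel r M M') (h' : Rel r N N') : Rel r (pair M N) (pair M' N')
  | fst {Γ : List Ty} {σ τ : Ty} {M M' : Tm S Γ (Ty.prod σ τ)} (h : Rel r M M') :
      Rel r (fst M) (fst M')
  | snd {Γ : List Ty} {σ τ : Ty} {M M' : Tm S Γ (Ty.prod σ τ)} (h : Rel r M M') :
      Rel r (snd M) (snd M')
  | inl {Γ : List Ty} {σ τ : Ty} {M M' : Tm S Γ σ} (h : Rel r M M') :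
      Rel r (inl M : Tm S Γ (Ty.sum σ τ)) (inl M')
  | inr {Γ : List Ty} {σ τ : Ty} {M M' : Tm S Γ τ} (h : Rel r M M') :
      Rel r (inr M : Tm S Γ (Ty.sum σ τ)) (inr M')
  | case {Γ : List Ty} {σ τ υ : Ty} {M M' : Tm S Γ (Ty.sum σ τ)} {N N' : Tm S Γ (Ty.arr σ υ)}
      {P P' : Tm S Γ (Ty.arr τ υ)} (h : Rel r M M') (h' : Rel r N N') (h'' : Rel r P P') :
      Rel r (case M N P) (case M' N' P')

theorem Rel.refl {r : PDcpo.real → PDcpo.real → Prop} (hr : ∀ a, r a a) {Γ : List Ty} {τ : Ty}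
    (M : Tm S Γ τ) : Rel r M M := by
  induction M <;> constructor <;> first | assumption | exact hr _

theorem Rel.trans {r : PDcpo.real → PDcpo.real → Prop} (hr : ∀ a b c, r a b → r b c → r a c)
    {Γ : List Ty} {τ : Ty} {M N P : Tm S Γ τ} (h : Rel r M N) (h' : Rel r N P) : Rel r M P := by
  induction h <;> cases h' <;> constructor <;> first | exact hr _ _ _ ‹_› ‹_› | solve_by_elim

theorem Rel.swap {r : PDcpo.real → PDcpo.real → Prop} {Γ : List Ty} {τ : Ty} {M N : Tm S Γ τ}
    (h : Rel r M N) : Rel (fun a b => r b a) N M := by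
  induction h <;> constructor <;> assumption

theorem Rel.antisymm {r : PDcpo.real → PDcpo.real → Prop} (hr : ∀ a b, r a b → r b a → a = b)
    {Γ : List Ty} {τ : Ty} {M N : Tm S Γ τ} (h : Rel r M N) (h' : Rel r N M) : M = N := by
  induction h <;> cases h' <;> congr <;> first | exact hr _ _ ‹_› ‹_› | solve_by_elim

/-- Terms are ordered by comparing their constants of type `real`, at equal shapes. -/
instance {Γ : List Ty} {τ : Ty} : PartialOrder (Tm S Γ τ) where
  le := Rel (· ≤ ·)
  le_refl := Rel.refl fun _ => le_rfl
  le_trans _ _ _ h h' := Rel.trans (r := (· ≤ ·)) (fun _ _ _ h1 h2 => le_trans h1 h2) h h'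
  le_antisymm _ _ h h' := Rel.antisymm (r := (· ≤ ·)) (fun _ _ h1 h2 => le_antisymm h1 h2) h h'

/-- The space of configurations carries the Scott topology. -/
instance {Γ : List Ty} {τ : Ty} : TopologicalSpace (Tm S Γ τ) := Topology.scott _ Set.univ

instance {Γ : List Ty} {τ : Ty} : Topology.IsScott (Tm S Γ τ) Set.univ := ⟨rfl⟩

end Tm

section operational
variable {S : Signature}

/-! ### Operational semantics -/

/-- The term that denotes an observable element; `none` on other elements. -/
def quote (S : Signature) : (τ : Ty) → τ.den → Option (Tm S [] τ)
  | Ty.unit, v =>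
    match (v : WithBot (Disc Unit)) with
    | some _ => some Tm.star
    | none => none
  | Ty.void, _ => none
  | Ty.int, v =>
    match (v : WithBot (Disc ℤ)) with
    | some n => some (Tm.int n.val)
    | none => none
  | Ty.real, v =>
    match (v : WithBot IR) with
    | some x => some (Tm.real ((x : IR) : WithBot IR))
    | none => none
  | Ty.sum σ τ, v =>
    match (v : WithBot (σ.den ⊕ τ.den)) with
    | some (Sum.inl a) => (quote S σ a).map Tm.inl
    | some (Sum.inr b) => (quote S τ b).map Tm.inr
    | none => none
  | Ty.prod σ τ, v =>
    match quote S σ (v : σ.den × τ.den).1, quote S τ (v : σ.den × τ.den).2 with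
    | some M, some N => some (Tm.pair M N)
    | _, _ => none
  | Ty.arr _ _, _ => none
  | Ty.dist _, _ => none

theorem obs_iff_quote : (τ : Ty) → (v : τ.den) → (τ.Obs v ↔ ∃ M, quote S τ v = some M)
  | Ty.unit, v => by
    rcases v with _ | v
    · exact ⟨fun h => absurd rfl h, fun ⟨M, h⟩ => by cases h⟩
    · exact ⟨fun _ => ⟨_, rfl⟩, fun _ h => by cases h⟩
  | Ty.void, v => ⟨fun h => absurd rfl h, fun ⟨M, h⟩ => by cases h⟩
  | Ty.int, v => by
    rcases v with _ | v
    · exact ⟨fun h => absurd rfl h, fun ⟨M, h⟩ => by cases h⟩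
    · exact ⟨fun _ => ⟨_, rfl⟩, fun _ h => by cases h⟩
  | Ty.real, v => by
    rcases v with _ | v
    · exact ⟨fun h => absurd rfl h, fun ⟨M, h⟩ => by cases h⟩
    · exact ⟨fun _ => ⟨_, rfl⟩, fun _ h => by cases h⟩
  | Ty.sum σ τ, v => by
    rcases v with _ | (v | v)
    · exact ⟨fun h => absurd h id, fun ⟨M, h⟩ => by cases h⟩
    · refine (obs_iff_quote σ v).trans ?_
      change _ ↔ ∃ M, (quote S σ v).map Tm.inl = some M
      simp [Option.map_eq_some_iff]
    · refine (obs_iff_quote τ v).trans ?_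
      change _ ↔ ∃ M, (quote S τ v).map Tm.inr = some M
      simp [Option.map_eq_some_iff]
  | Ty.prod σ τ, v => by
    rcases v with ⟨a, b⟩
    refine (and_congr (obs_iff_quote σ a) (obs_iff_quote τ b)).trans ?_
    change _ ↔ ∃ M, (match quote S σ a, quote S τ b with
      | some M, some N => some (Tm.pair M N)
      | _, _ => none) = some M
    cases quote S σ a <;> cases quote S τ b <;> simp
  | Ty.arr _ _, v => ⟨fun h => absurd h id, fun ⟨M, h⟩ => by cases h⟩
  | Ty.dist _, v => ⟨fun h => absurd h id, fun ⟨M, h⟩ => by cases h⟩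

/-- The zero-ary constants of basic types. -/
inductive IsConst : {τ : Ty} → Tm S [] τ → Prop
  | star : IsConst Tm.star
  | int (n : ℤ) : IsConst (Tm.int n)
  | real (a : PDcpo.real) : IsConst (Tm.real a)
  | con {τ : Ty} (c : S.Con) (h : S.typ c = τ) (hb : τ.IsBasic) : IsConst (Tm.con c h)

/-- `Spine c i M` says that `M` is `c a₁ ⋯ aᵢ`, where each `aⱼ` is a zero-ary constant of basic
type. -/
inductive Spine (c : S.Con) : ℕ → {τ : Ty} → Tm S [] τ → Prop
  | con {τ : Ty} (h : S.typ c = τ) : Spine c 0 (Tm.con c h)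
  | app {i : ℕ} {σ τ : Ty} {M : Tm S [] (Ty.arr σ τ)} {N : Tm S [] σ} (hM : Spine c i M)
      (hN : IsConst N) : Spine c (i + 1) (Tm.app M N)

/-- `M` is `c a₁ ⋯ aₖ`, where `k ≠ 0` is the arity of `c` and each `aⱼ` is a zero-ary constant of
basic type. Then `c (a₁) ⋯ (aₖ)`, the application of the semantics of `c` to the elements denoted by
the arguments, is the denotation `M.eval`. -/
def IsSaturated {τ : Ty} (M : Tm S [] τ) : Prop :=
  ∃ c : S.Con, (S.typ c).arity ≠ 0 ∧ Spine c (S.typ c).arity M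

/-- Values. -/
inductive IsValue : {τ : Ty} → Tm S [] τ → Prop
  | const {τ : Ty} {M : Tm S [] τ} (h : IsConst M) : IsValue M
  | lam {σ τ : Ty} (M : Tm S [σ] τ) : IsValue (Tm.lam M)
  | ret {τ : Ty} {V : Tm S [] τ} (h : IsValue V) : IsValue (Tm.ret V)
  | pair {σ τ : Ty} {V : Tm S [] σ} {W : Tm S [] τ} (h : IsValue V) (h' : IsValue W) :
      IsValue (Tm.pair V W)
  | inl {σ τ : Ty} {V : Tm S [] σ} (h : IsValue V) : IsValue (Tm.inl V : Tm S [] (Ty.sum σ τ))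
  | inr {σ τ : Ty} {V : Tm S [] τ} (h : IsValue V) : IsValue (Tm.inr V : Tm S [] (Ty.sum σ τ))
  | spine {c : S.Con} {i : ℕ} {τ : Ty} {M : Tm S [] τ} (h : Spine c i M)
      (hi : i < (S.typ c).arity) : IsValue M

/-- Weak evaluation contexts with a hole of type `σ`. -/
inductive WCtx (S : Signature) (σ : Ty) : Ty → Type _
  | hole : WCtx S σ σ
  | score (E : WCtx S σ Ty.real) : WCtx S σ (Ty.dist Ty.unit)
  | app {ρ τ : Ty} (E : WCtx S σ (Ty.arr ρ τ)) (N : Tm S [] ρ) : WCtx S σ τ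
  | bind {ρ τ : Ty} (E : WCtx S σ (Ty.dist ρ)) (N : Tm S [ρ] (Ty.dist τ)) : WCtx S σ (Ty.dist τ)
  | arg {ρ τ : Ty} (M : Tm S [] (Ty.arr ρ τ)) (c : S.Con) (i : ℕ) (hM : Spine c i M)
      (hi : i < (S.typ c).arity) (E : WCtx S σ ρ) : WCtx S σ τ
  | case {ρ ρ' τ : Ty} (E : WCtx S σ (Ty.sum ρ ρ')) (N : Tm S [] (Ty.arr ρ τ))
      (P : Tm S [] (Ty.arr ρ' τ)) : WCtx S σ τ
  | fst {ρ τ : Ty} (E : WCtx S σ (Ty.prod τ ρ)) : WCtx S σ τ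
  | snd {ρ τ : Ty} (E : WCtx S σ (Ty.prod ρ τ)) : WCtx S σ τ

/-- Evaluation contexts with a hole of type `σ`. -/
inductive ECtx (S : Signature) (σ : Ty) : Ty → Type _
  | weak {τ : Ty} (E : WCtx S σ τ) : ECtx S σ τ
  | ret {τ : Ty} (E : ECtx S σ τ) : ECtx S σ (Ty.dist τ)
  | pairLeft {ρ τ : Ty} (E : ECtx S σ ρ) (M : Tm S [] τ) : ECtx S σ (Ty.prod ρ τ)
  | pairRight {ρ τ : Ty} (V : Tm S [] ρ) (hV : IsValue V) (E : ECtx S σ τ) :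
      ECtx S σ (Ty.prod ρ τ)
  | inl {ρ τ : Ty} (E : ECtx S σ ρ) : ECtx S σ (Ty.sum ρ τ)
  | inr {ρ τ : Ty} (E : ECtx S σ τ) : ECtx S σ (Ty.sum ρ τ)

/-- The term `E[M]`, for a weak evaluation context `E`. -/
def WCtx.fill {σ : Ty} : {τ : Ty} → WCtx S σ τ → Tm S [] σ → Tm S [] τ
  | _, hole, M => M
  | _, score E, M => Tm.score (E.fill M)
  | _, app E N, M => Tm.app (E.fill M) N
  | _, bind E N, M => Tm.bind (E.fill M) N
  | _, arg P _ _ _ _ E, M => Tm.app P (E.fill M)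
  | _, case E N P, M => Tm.case (E.fill M) N P
  | _, fst E, M => Tm.fst (E.fill M)
  | _, snd E, M => Tm.snd (E.fill M)

/-- The term `E[M]`. -/
def ECtx.fill {σ : Ty} : {τ : Ty} → ECtx S σ τ → Tm S [] σ → Tm S [] τ
  | _, weak E, M => E.fill M
  | _, ret E, M => Tm.ret (E.fill M)
  | _, pairLeft E N, M => Tm.pair (E.fill M) N
  | _, pairRight V _ E, M => Tm.pair V (E.fill M)
  | _, inl E, M => Tm.inl (E.fill M)
  | _, inr E, M => Tm.inr (E.fill M)

/-- The deterministic rules other than that for constants, without evaluation contexts. -/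
inductive DetStep : {τ : Ty} → Tm S [] τ → Tm S [] τ → Prop
  | fix {τ : Ty} (M : Tm S [] (Ty.arr τ τ)) : DetStep (Tm.fix M) (Tm.app M (Tm.fix M))
  | beta {σ τ : Ty} (M : Tm S [σ] τ) (N : Tm S [] σ) :
      DetStep (Tm.app (Tm.lam M) N) (M.inst N)
  | fst {σ τ : Ty} (M : Tm S [] σ) (N : Tm S [] τ) : DetStep (Tm.fst (Tm.pair M N)) M
  | snd {σ τ : Ty} (M : Tm S [] σ) (N : Tm S [] τ) : DetStep (Tm.snd (Tm.pair M N)) N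
  | inl {σ τ υ : Ty} (M : Tm S [] σ) (N : Tm S [] (Ty.arr σ υ)) (P : Tm S [] (Ty.arr τ υ)) :
      DetStep (Tm.case (Tm.inl M) N P) (Tm.app N M)
  | inr {σ τ υ : Ty} (M : Tm S [] τ) (N : Tm S [] (Ty.arr σ υ)) (P : Tm S [] (Ty.arr τ υ)) :
      DetStep (Tm.case (Tm.inr M) N P) (Tm.app P M)

/-- The raw operational semantics. -/
inductive Step : {τ : Ty} → Tm S [] τ → Tm S [] τ → Prop
  | sample {τ : Ty} (E : WCtx S (Ty.dist Ty.real) τ) (μ : MeasureTheory.Measure ℝ)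
      (h : μ ∈ S.meas) (a : ℝ) :
      Step (E.fill (Tm.sample μ h)) (E.fill (Tm.ret (Tm.real (PDcpo.ofReal a))))
  | score {τ : Ty} (E : WCtx S (Ty.dist Ty.unit) τ) (a : PDcpo.real) :
      Step (E.fill (Tm.score (Tm.real a))) (E.fill (Tm.ret Tm.star))
  | bind {ρ σ τ : Ty} (E : WCtx S (Ty.dist ρ) τ) (M : Tm S [] σ) (N : Tm S [σ] (Ty.dist ρ)) :
      Step (E.fill (Tm.bind (Tm.ret M) N)) (E.fill (N.inst M))
  | det {σ τ : Ty} (E : ECtx S σ τ) {L R : Tm S [] σ} (h : DetStep L R) :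
      Step (E.fill L) (E.fill R)
  | con {σ τ : Ty} (E : ECtx S σ τ) {L R : Tm S [] σ} (hL : IsSaturated L)
      (hR : quote S σ L.eval = some R) : Step (E.fill L) (E.fill R)

/-- Redexes. -/
def IsRedex {τ : Ty} (M : Tm S [] τ) : Prop := ∃ N, Step M N

/-- Blocked terms. -/
def IsBlocked {τ : Ty} (M : Tm S [] τ) : Prop :=
  ∃ (σ : Ty) (E : ECtx S σ τ) (L : Tm S [] σ), IsSaturated L ∧ ¬ σ.Obs L.eval ∧ M = E.fill L

/-- Normal forms. -/
def IsNormal {τ : Ty} (M : Tm S [] τ) : Prop := ¬ IsRedex M ∧ ¬ IsBlocked M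

/-! ### Normal forms are open and closed -/

section rel
variable {r : PDcpo.real → PDcpo.real → Prop}

theorem IsConst.rel {τ : Ty} {M N : Tm S [] τ} (hM : IsConst M) (h : Tm.Rel r M N) :
    IsConst N := by
  cases hM <;> cases h <;> constructor
  assumption

theorem Spine.rel {c : S.Con} {i : ℕ} {τ : Ty} {M N : Tm S [] τ} (hM : Spine c i M)
    (h : Tm.Rel r M N) : Spine c i N := by
  induction hM with
  | con h => cases h; constructor
  | app hM hN ih =>
    cases h with
    | app h h' => exact Spine.app (ih h) (hN.rel h')

theorem IsSaturated.rel {τ : Ty} {M N : Tm S [] τ} (hM : IsSaturated M) (h : Tm.Rel r M N) :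
    IsSaturated N := by
  obtain ⟨c, hc, hM⟩ := hM
  exact ⟨c, hc, hM.rel h⟩

theorem IsValue.rel {τ : Ty} {M N : Tm S [] τ} (hM : IsValue M) (h : Tm.Rel r M N) :
    IsValue N := by
  induction hM with
  | const hM => exact .const (hM.rel h)
  | lam M => cases h; exact .lam _
  | ret _ ih => cases h with | ret h => exact .ret (ih h)
  | pair _ _ ih ih' => cases h with | pair h h' => exact .pair (ih h) (ih' h')
  | inl _ ih => cases h with | inl h => exact .inl (ih h)
  | inr _ ih => cases h with | inr h => exact .inr (ih h)
  | spine hM hi => exact .spine (hM.rel h) hi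

theorem WCtx.rel {σ τ : Ty} (E : WCtx S σ τ) {L : Tm S [] σ} {N : Tm S [] τ}
    (h : Tm.Rel r (E.fill L) N) :
    ∃ (E' : WCtx S σ τ) (L' : Tm S [] σ), Tm.Rel r L L' ∧ N = E'.fill L' := by
  induction E with
  | hole => exact ⟨.hole, N, h, rfl⟩
  | score E ih =>
    cases h with | score h => obtain ⟨E', L', h1, rfl⟩ := ih h; exact ⟨.score E', L', h1, rfl⟩
  | app E N ih =>
    cases h with
    | @app _ _ _ _ _ _ N' h h' =>
      obtain ⟨E', L', h1, rfl⟩ := ih h; exact ⟨.app E' N', L', h1, rfl⟩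
  | bind E N ih =>
    cases h with
    | @bind _ _ _ _ _ _ N' h h' =>
      obtain ⟨E', L', h1, rfl⟩ := ih h; exact ⟨.bind E' N', L', h1, rfl⟩
  | arg M c i hM hi E ih =>
    cases h with
    | app h h' =>
      obtain ⟨E', L', h1, rfl⟩ := ih h'; exact ⟨.arg _ c i (hM.rel h) hi E', L', h1, rfl⟩
  | case E N P ih =>
    cases h with
    | @case _ _ _ _ _ _ _ N' _ P' h h' h'' =>
      obtain ⟨E', L', h1, rfl⟩ := ih h; exact ⟨.case E' N' P', L', h1, rfl⟩
  | fst E ih =>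
    cases h with | fst h => obtain ⟨E', L', h1, rfl⟩ := ih h; exact ⟨.fst E', L', h1, rfl⟩
  | snd E ih =>
    cases h with | snd h => obtain ⟨E', L', h1, rfl⟩ := ih h; exact ⟨.snd E', L', h1, rfl⟩

theorem ECtx.rel {σ τ : Ty} (E : ECtx S σ τ) {L : Tm S [] σ} {N : Tm S [] τ}
    (h : Tm.Rel r (E.fill L) N) :
    ∃ (E' : ECtx S σ τ) (L' : Tm S [] σ), Tm.Rel r L L' ∧ N = E'.fill L' := by
  induction E with
  | weak E => obtain ⟨E', L', h1, rfl⟩ := E.rel h; exact ⟨.weak E', L', h1, rfl⟩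
  | ret E ih =>
    cases h with | ret h => obtain ⟨E', L', h1, rfl⟩ := ih h; exact ⟨.ret E', L', h1, rfl⟩
  | pairLeft E N ih =>
    cases h with
    | @pair _ _ _ _ _ _ N' h h' =>
      obtain ⟨E', L', h1, rfl⟩ := ih h; exact ⟨.pairLeft E' N', L', h1, rfl⟩
  | pairRight V hV E ih =>
    cases h with
    | pair h h' =>
      obtain ⟨E', L', h1, rfl⟩ := ih h'; exact ⟨.pairRight _ (hV.rel h) E', L', h1, rfl⟩
  | inl E ih =>
    cases h with | inl h => obtain ⟨E', L', h1, rfl⟩ := ih h; exact ⟨.inl E', L', h1, rfl⟩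
  | inr E ih =>
    cases h with | inr h => obtain ⟨E', L', h1, rfl⟩ := ih h; exact ⟨.inr E', L', h1, rfl⟩

theorem DetStep.rel {τ : Ty} {L R L' : Tm S [] τ} (hL : DetStep L R) (h : Tm.Rel r L L') :
    ∃ R', DetStep L' R' := by
  cases hL with
  | fix M => cases h; exact ⟨_, .fix _⟩
  | beta M N => cases h with | app h h' => cases h; exact ⟨_, .beta _ _⟩
  | fst M N => cases h with | fst h => cases h; exact ⟨_, .fst _ _⟩
  | snd M N => cases h with | snd h => cases h; exact ⟨_, .snd _ _⟩
  | inl M N P => cases h with | case h h' h'' => cases h; exact ⟨_, .inl _ _ _⟩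
  | inr M N P => cases h with | case h h' h'' => cases h; exact ⟨_, .inr _ _ _⟩

theorem saturated_not_normal {σ τ : Ty} (E : ECtx S σ τ) {L : Tm S [] σ} (hL : IsSaturated L) :
    IsRedex (E.fill L) ∨ IsBlocked (E.fill L) := by
  by_cases h : σ.Obs L.eval
  · obtain ⟨R, hR⟩ := (obs_iff_quote σ L.eval).1 h
    exact .inl ⟨_, .con E hL hR⟩
  · exact .inr ⟨σ, E, L, hL, h, rfl⟩

theorem not_normal_rel {τ : Ty} {M N : Tm S [] τ} (h : Tm.Rel r M N)
    (hM : IsRedex M ∨ IsBlocked M) : IsRedex N ∨ IsBlocked N := by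
  rcases hM with ⟨M', hM⟩ | ⟨σ, E, L, hL, -, rfl⟩
  · cases hM with
    | sample E μ hμ a =>
      obtain ⟨E', L', h1, rfl⟩ := E.rel h
      cases h1
      exact .inl ⟨_, .sample E' μ hμ 0⟩
    | score E a =>
      obtain ⟨E', L', h1, rfl⟩ := E.rel h
      cases h1 with
      | score h1 => cases h1; exact .inl ⟨_, .score E' _⟩
    | bind E M N =>
      obtain ⟨E', L', h1, rfl⟩ := E.rel h
      cases h1 with
      | bind h1 h2 => cases h1; exact .inl ⟨_, .bind E' _ _⟩
    | det E hL =>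
      obtain ⟨E', L', h1, rfl⟩ := E.rel h
      obtain ⟨R', hR'⟩ := hL.rel h1
      exact .inl ⟨_, .det E' hR'⟩
    | con E hL hR =>
      obtain ⟨E', L', h1, rfl⟩ := E.rel h
      exact saturated_not_normal E' (hL.rel h1)
  · obtain ⟨E', L', h1, rfl⟩ := E.rel h
    exact saturated_not_normal E' (hL.rel h1)

theorem normal_iff_rel {τ : Ty} {M N : Tm S [] τ} (h : Tm.Rel r M N) :
    IsNormal M ↔ IsNormal N := by
  rw [IsNormal, IsNormal, ← not_or, ← not_or, not_iff_not]
  exact ⟨not_normal_rel h, not_normal_rel h.swap⟩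

end rel

theorem Tm.isOpen_iff {Γ : List Ty} {τ : Ty} {s : Set (Tm S Γ τ)} :
    IsOpen s ↔ IsUpperSet s ∧ DirSupInacc s := by
  rw [Topology.IsScott.isOpen_iff_isUpperSet_and_dirSupInaccOn (D := Set.univ), dirSupInaccOn_univ]

/-- The open set of normal forms. -/
def normalForms (S : Signature) (τ : Ty) : Opens (Tm S [] τ) where
  carrier := {M | IsNormal M}
  is_open' := by
    refine Tm.isOpen_iff.2 ⟨fun M N h hM => (normal_iff_rel h).1 hM, ?_⟩
    rintro d ⟨N, hN⟩ _ M hM hM'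
    exact ⟨N, hN, (normal_iff_rel (hM.1 hN)).2 hM'⟩

/-! ### The denotation of configurations is Scott-continuous -/


/-! ### The denotation of configurations is Scott-continuous -/

/-- A monotone family `g` with least upper bound `a`. -/
structure Lub {ι P : Type*} [Preorder ι] [Preorder P] (g : ι → P) (a : P) : Prop where
  mono : Monotone g
  lub : IsLUB (Set.range g) a

namespace Lub
variable {ι : Type*} [Preorder ι]

theorem const [Nonempty ι] {P : Type*} [Preorder P] (a : P) : Lub (fun _ : ι => a) a :=
  ⟨fun _ _ _ => le_rfl, by rw [Set.range_const]; exact isLUB_singleton⟩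

theorem le {P : Type*} [Preorder P] {g : ι → P} {a : P} (h : Lub g a) (i : ι) : g i ≤ a :=
  h.lub.1 ⟨i, rfl⟩

theorem fst {P Q : Type*} [Preorder P] [Preorder Q] {g : ι → P × Q} {a : P × Q} (h : Lub g a) :
    Lub (fun i => (g i).1) a.1 :=
  ⟨fun _ _ hij => (h.mono hij).1, by
    have := (isLUB_prod.1 h.lub).1
    rwa [← Set.range_comp] at this⟩

theorem snd {P Q : Type*} [Preorder P] [Preorder Q] {g : ι → P × Q} {a : P × Q} (h : Lub g a) :
    Lub (fun i => (g i).2) a.2 :=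
  ⟨fun _ _ hij => (h.mono hij).2, by
    have := (isLUB_prod.1 h.lub).2
    rwa [← Set.range_comp] at this⟩

theorem prodMk {P Q : Type*} [Preorder P] [Preorder Q] {g : ι → P} {h : ι → Q} {a : P} {b : Q}
    (hg : Lub g a) (hh : Lub h b) : Lub (fun i => (g i, h i)) (a, b) :=
  ⟨fun _ _ hij => ⟨hg.mono hij, hh.mono hij⟩, isLUB_prod.2 ⟨by
    rw [← Set.range_comp]; exact hg.lub, by rw [← Set.range_comp]; exact hh.lub⟩⟩

theorem map [Nonempty ι] [IsDirectedOrder ι] {P Q : Type*} [Preorder P] [Preorder Q] {f : P → Q}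
    (hf : ScottContinuous f) {g : ι → P} {a : P} (h : Lub g a) : Lub (fun i => f (g i)) (f a) :=
  ⟨hf.monotone.comp h.mono, by
    have := hf (Set.range_nonempty g) h.mono.directed_le.directedOn_range h.lub
    rwa [← Set.range_comp] at this⟩

theorem sc {X Y : PDcpo} {F : ι → SC X Y} {f : SC X Y} (h : ∀ x, Lub (fun i => F i x) (f x)) :
    Lub F f :=
  ⟨fun _ _ hij x => (h x).mono hij, by
    rintro _ ⟨i, rfl⟩ x
    exact (h x).le i, fun g hg x => (h x).lub.2 (by
      rintro _ ⟨i, rfl⟩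
      exact hg ⟨i, rfl⟩ x)⟩

/-- Families below `K a`, for a lower embedding `K`, come from families below `a`. -/
theorem lift {P Q : Type*} [PartialOrder P] [PartialOrder Q] (K : P → Q)
    (hK : ∀ a b, K a ≤ K b ↔ a ≤ b) (hinv : ∀ x a, x ≤ K a → ∃ b, x = K b)
    {g : ι → Q} {a : P} (h : Lub g (K a)) : ∃ k : ι → P, g = (fun i => K (k i)) ∧ Lub k a := by
  choose k hk using fun i => hinv (g i) a (h.le i)
  obtain rfl : g = fun i => K (k i) := funext hk
  refine ⟨k, rfl, fun i j hij => (hK _ _).1 (h.mono hij), ?_, fun b hb => ?_⟩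
  · rintro _ ⟨i, rfl⟩
    exact (hK _ _).1 (h.le i)
  · refine (hK _ _).1 (h.lub.2 ?_)
    rintro _ ⟨i, rfl⟩
    exact (hK _ _).2 (hb ⟨i, rfl⟩)

end Lub

namespace Tm

theorem den_lub {ι : Type*} [Preorder ι] [Nonempty ι] [IsDirectedOrder ι] {Γ : List Ty} {τ : Ty}
    (M : Tm S Γ τ) (g : ι → Tm S Γ τ) (h : Lub g M) (ρ : ctxDen Γ) :
    Lub (fun i => (g i).den ρ) (M.den ρ) := by
  have leaf : ∀ {Γ τ} {M : Tm S Γ τ} {g : ι → Tm S Γ τ}, (∀ N, N ≤ M → N = M) → Lub g M →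
      ∀ ρ, Lub (fun i => (g i).den ρ) (M.den ρ) := by
    intro Γ τ M g hM h ρ
    obtain rfl : g = fun _ => M := funext fun i => hM _ (h.le i)
    exact Lub.const _
  induction M with
  | var x => exact leaf (fun N h => by cases h; rfl) h ρ
  | star => exact leaf (fun N h => by cases h; rfl) h ρ
  | int n => exact leaf (fun N h => by cases h; rfl) h ρ
  | con c hc => exact leaf (fun N h => by cases h; rfl) h ρ
  | sample μ hμ => exact leaf (fun N h => by cases h; rfl) h ρ
  | real a =>
    obtain ⟨k, rfl, hk⟩ := Lub.lift Tm.real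
      (fun a b => ⟨fun h => by cases h; assumption, fun h => Rel.real h⟩)
      (fun x a h => by cases h; exact ⟨_, rfl⟩) h
    exact hk
  | score M ih =>
    obtain ⟨k, rfl, hk⟩ := Lub.lift Tm.score
      (fun a b => ⟨fun h => by cases h; assumption, fun h => Rel.score h⟩)
      (fun x a h => by cases h; exact ⟨_, rfl⟩) h
    exact (ih k hk ρ).map SC.score.scott
  | lam M ih =>
    obtain ⟨k, rfl, hk⟩ := Lub.lift Tm.lam
      (fun a b => ⟨fun h => by cases h; assumption, fun h => Rel.lam h⟩)
      (fun x a h => by cases h; exact ⟨_, rfl⟩) h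
    exact Lub.sc fun x => ih k hk (x, ρ)
  | app M N ih ih' =>
    obtain ⟨k, rfl, hk⟩ := Lub.lift (fun p : Tm S _ _ × Tm S _ _ => Tm.app p.1 p.2)
      (a := (M, N))
      (fun a b => ⟨fun h => by cases h; constructor <;> assumption, fun h => Rel.app (Prod.le_def.1 h).1 (Prod.le_def.1 h).2⟩)
      (fun x a h => by cases h; exact ⟨(_, _), rfl⟩) h
    exact ((ih _ hk.fst ρ).prodMk (ih' _ hk.snd ρ)).map SC.app.scott
  | fix M ih =>
    obtain ⟨k, rfl, hk⟩ := Lub.lift Tm.fix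
      (fun a b => ⟨fun h => by cases h; assumption, fun h => Rel.fix h⟩)
      (fun x a h => by cases h; exact ⟨_, rfl⟩) h
    exact (ih k hk ρ).map SC.fix.scott
  | ret M ih =>
    obtain ⟨k, rfl, hk⟩ := Lub.lift Tm.ret
      (fun a b => ⟨fun h => by cases h; assumption, fun h => Rel.ret h⟩)
      (fun x a h => by cases h; exact ⟨_, rfl⟩) h
    exact (ih k hk ρ).map SC.ret.scott
  | bind M N ih ih' =>
    obtain ⟨k, rfl, hk⟩ := Lub.lift (fun p : Tm S _ _ × Tm S _ _ => Tm.bind p.1 p.2)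
      (a := (M, N))
      (fun a b => ⟨fun h => by cases h; constructor <;> assumption, fun h => Rel.bind (Prod.le_def.1 h).1 (Prod.le_def.1 h).2⟩)
      (fun x a h => by cases h; exact ⟨(_, _), rfl⟩) h
    exact (Lub.prodMk (Lub.sc fun x => ih' _ hk.snd (x, ρ)) (ih _ hk.fst ρ)).map SC.bind.scott
  | pair M N ih ih' =>
    obtain ⟨k, rfl, hk⟩ := Lub.lift (fun p : Tm S _ _ × Tm S _ _ => Tm.pair p.1 p.2)
      (a := (M, N))
      (fun a b => ⟨fun h => by cases h; constructor <;> assumption, fun h => Rel.pair (Prod.le_def.1 h).1 (Prod.le_def.1 h).2⟩)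
      (fun x a h => by cases h; exact ⟨(_, _), rfl⟩) h
    exact (ih _ hk.fst ρ).prodMk (ih' _ hk.snd ρ)
  | fst M ih =>
    obtain ⟨k, rfl, hk⟩ := Lub.lift Tm.fst
      (fun a b => ⟨fun h => by cases h; assumption, fun h => Rel.fst h⟩)
      (fun x a h => by cases h; exact ⟨_, rfl⟩) h
    exact (ih k hk ρ).map SC.fst.scott
  | snd M ih =>
    obtain ⟨k, rfl, hk⟩ := Lub.lift Tm.snd
      (fun a b => ⟨fun h => by cases h; assumption, fun h => Rel.snd h⟩)
      (fun x a h => by cases h; exact ⟨_, rfl⟩) h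
    exact (ih k hk ρ).map SC.snd.scott
  | inl M ih =>
    obtain ⟨k, rfl, hk⟩ := Lub.lift Tm.inl
      (fun a b => ⟨fun h => by cases h; assumption, fun h => Rel.inl h⟩)
      (fun x a h => by cases h; exact ⟨_, rfl⟩) h
    exact (ih k hk ρ).map SC.inl.scott
  | inr M ih =>
    obtain ⟨k, rfl, hk⟩ := Lub.lift Tm.inr
      (fun a b => ⟨fun h => by cases h; assumption, fun h => Rel.inr h⟩)
      (fun x a h => by cases h; exact ⟨_, rfl⟩) h
    exact (ih k hk ρ).map SC.inr.scott
  | case M N P ih ih' ih'' =>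
    obtain ⟨k, rfl, hk⟩ := Lub.lift
      (fun p : Tm S _ _ × Tm S _ _ × Tm S _ _ => Tm.case p.1 p.2.1 p.2.2) (a := (M, N, P))
      (fun a b => ⟨fun h => by cases h; refine ⟨?_, ?_, ?_⟩ <;> assumption,
        fun h => Rel.case (Prod.le_def.1 h).1 (Prod.le_def.1 (Prod.le_def.1 h).2).1
          (Prod.le_def.1 (Prod.le_def.1 h).2).2⟩)
      (fun x a h => by cases h; exact ⟨(_, _, _), rfl⟩) h
    exact ((ih _ hk.fst ρ).prodMk ((ih' _ hk.snd.fst ρ).prodMk (ih'' _ hk.snd.snd ρ))).map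
      SC.case.scott

theorem eval_scott {τ : Ty} : ScottContinuous (eval (S := S) (τ := τ)) := by
  intro d hne hd M hM
  have : Nonempty d := hne.to_subtype
  have : IsDirectedOrder d := directedOn_iff_isDirectedOrder.1 hd
  have h : Lub (fun i : d => (i : Tm S [] τ)) M := ⟨fun _ _ h => h, by simpa using hM⟩
  have := (den_lub M _ h PUnit.unit).lub
  rw [Set.image_eq_range]
  exact this

end Tm

/-- The open set of normal forms `ret V`, where `V` is a normal form of type `τ` whose denotation is
in `U`. -/
def rover {S : Signature} {τ : Ty} (U : Opens τ.den) : Opens (Tm S [] (Ty.dist τ)) where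
  carrier := {M | ∃ V : Tm S [] τ, M = Tm.ret V ∧ IsNormal V ∧ V.eval ∈ U}
  is_open' := by
    refine Tm.isOpen_iff.2 ⟨?_, ?_⟩
    · rintro _ N h ⟨V, rfl, hV, hU⟩
      cases h with
      | ret h =>
        exact ⟨_, rfl, (normal_iff_rel h).1 hV,
          (PDcpo.isOpen_iff.1 U.isOpen).1 (Tm.eval_scott.monotone h) hU⟩
    · rintro d hne hd _ hM ⟨V, rfl, hV, hU⟩
      have : Nonempty d := hne.to_subtype
      have : IsDirectedOrder d := directedOn_iff_isDirectedOrder.1 hd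
      have h : Lub (fun i : d => (i : Tm S [] (Ty.dist τ))) (Tm.ret V) :=
        ⟨fun _ _ h => h, by simpa using hM⟩
      obtain ⟨k, hk, hkV⟩ := Lub.lift Tm.ret
        (fun a b => ⟨fun h => by cases h; assumption, fun h => Tm.Rel.ret h⟩)
        (fun x a h => by cases h; exact ⟨_, rfl⟩) h
      have h1 := hkV.map Tm.eval_scott
      obtain ⟨_, ⟨i, rfl⟩, hi⟩ := (PDcpo.isOpen_iff.1 U.isOpen).2 (Set.range_nonempty _)
        h1.mono.directed_le.directedOn_range h1.lub hU
      exact ⟨i, i.2, k i, congrFun hk i, (normal_iff_rel (hkV.le i)).2 hV, hi⟩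

/-! ### The continuous kernel of the operational semantics -/

theorem WCtx.fill_le_fill {σ τ : Ty} (E : WCtx S σ τ) {M N : Tm S [] σ} :
    E.fill M ≤ E.fill N ↔ M ≤ N := by
  have hr : ∀ {τ : Ty} (M : Tm S [] τ), Tm.Rel (· ≤ ·) M M := Tm.Rel.refl fun _ => le_rfl
  induction E with
  | hole => exact Iff.rfl
  | score E ih => exact Iff.trans ⟨fun h => by cases h; assumption, Tm.Rel.score⟩ ih
  | app E N ih => exact Iff.trans ⟨fun h => by cases h; assumption, fun h => Tm.Rel.app h (hr _)⟩ ih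
  | bind E N ih =>
    exact Iff.trans ⟨fun h => by cases h; assumption, fun h => Tm.Rel.bind h (Tm.Rel.refl
      (fun _ => le_rfl) _)⟩ ih
  | arg M c i hM hi E ih =>
    exact Iff.trans ⟨fun h => by cases h; assumption, fun h => Tm.Rel.app (hr _) h⟩ ih
  | case E N P ih =>
    exact Iff.trans ⟨fun h => by cases h; assumption, fun h => Tm.Rel.case h (hr _) (hr _)⟩ ih
  | fst E ih => exact Iff.trans ⟨fun h => by cases h; assumption, Tm.Rel.fst⟩ ih
  | snd E ih => exact Iff.trans ⟨fun h => by cases h; assumption, Tm.Rel.snd⟩ ih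

theorem WCtx.fill_scott {σ τ : Ty} (E : WCtx S σ τ) : ScottContinuous E.fill := by
  intro d hne hd a ha
  refine ⟨?_, fun C hC => ?_⟩
  · rintro _ ⟨M, hM, rfl⟩
    exact E.fill_le_fill.2 (ha.1 hM)
  · replace hC : ∀ M ∈ d, E.fill M ≤ C := fun M hM => hC ⟨M, hM, rfl⟩
    obtain ⟨N, hN⟩ := hne
    induction E with
    | hole => exact ha.2 hC
    | score E ih =>
      cases hC N hN
      exact Tm.Rel.score (ih _ fun M hM => by cases hC M hM; assumption)
    | app E N ih =>
      cases hC _ hN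
      refine Tm.Rel.app (ih _ fun M hM => by cases hC M hM; assumption) ?_
      assumption
    | bind E N ih =>
      cases hC _ hN
      refine Tm.Rel.bind (ih _ fun M hM => by cases hC M hM; assumption) ?_
      assumption
    | arg M c i hM hi E ih =>
      cases hC _ hN
      refine Tm.Rel.app ?_ (ih _ fun M hM => by cases hC M hM; assumption)
      assumption
    | case E N P ih =>
      cases hC _ hN
      refine Tm.Rel.case (ih _ fun M hM => by cases hC M hM; assumption) ?_ ?_ <;> assumption
    | fst E ih =>
      cases hC N hN
      exact Tm.Rel.fst (ih _ fun M hM => by cases hC M hM; assumption)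
    | snd E ih =>
      cases hC N hN
      exact Tm.Rel.snd (ih _ fun M hM => by cases hC M hM; assumption)

theorem scottContinuous_ret_real :
    ScottContinuous fun a : PDcpo.real => (Tm.ret (Tm.real a) : Tm S [] _) := by
  intro d hne hd a ha
  refine ⟨?_, fun C hC => ?_⟩
  · rintro _ ⟨b, hb, rfl⟩
    exact Tm.Rel.ret (Tm.Rel.real (ha.1 hb))
  · obtain ⟨b, hb⟩ := hne
    replace hC : ∀ b ∈ d, Tm.ret (Tm.real b) ≤ C := fun b hb => hC ⟨b, hb, rfl⟩
    cases hC b hb with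
    | ret h =>
      cases h
      refine Tm.Rel.ret (Tm.Rel.real (ha.2 fun c hc => ?_))
      cases hC c hc with
      | ret h => cases h; assumption

/-- For an evaluation context `E`, the continuous map `a ↦ E[ret a]` on the real line. -/
def sampleMap {τ : Ty} (E : WCtx S (Ty.dist Ty.real) τ) : C(ℝ, Tm S [] τ) where
  toFun a := E.fill (Tm.ret (Tm.real (PDcpo.ofReal a)))
  continuous_toFun := by
    have h1 : ScottContinuous fun a : PDcpo.real => E.fill (Tm.ret (Tm.real a)) :=
      scottContinuous_ret_real.comp E.fill_scott
    exact ((Topology.IsScott.scottContinuousOn_iff_continuous (D := Set.univ) (by simp)).1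
      h1.scottContinuousOn).comp continuous_ofReal

/-- `NextIs M ν` says that the rules of the operational semantics assign the valuation `ν` to the
term `M`, which is a redex or a blocked term. -/
inductive NextIs : {τ : Ty} → Tm S [] τ → Valuation (Tm S [] τ) → Prop
  | sample {τ : Ty} (E : WCtx S (Ty.dist Ty.real) τ) (μ : MeasureTheory.Measure ℝ)
      (h : μ ∈ S.meas) :
      NextIs (E.fill (Tm.sample μ h)) ((Valuation.ofMeasure μ).map (sampleMap E))
  | score {τ : Ty} (E : WCtx S (Ty.dist Ty.unit) τ) (a : PDcpo.real) :
      NextIs (E.fill (Tm.score (Tm.real a)))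
        (((absVal a : ℝ≥0) : ℝ≥0∞) • Valuation.dirac (E.fill (Tm.ret Tm.star)))
  | bind {ρ σ τ : Ty} (E : WCtx S (Ty.dist ρ) τ) (M : Tm S [] σ) (N : Tm S [σ] (Ty.dist ρ)) :
      NextIs (E.fill (Tm.bind (Tm.ret M) N)) (Valuation.dirac (E.fill (N.inst M)))
  | det {σ τ : Ty} (E : ECtx S σ τ) {L R : Tm S [] σ} (h : DetStep L R) :
      NextIs (E.fill L) (Valuation.dirac (E.fill R))
  | con {σ τ : Ty} (E : ECtx S σ τ) {L R : Tm S [] σ} (hL : IsSaturated L)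
      (hR : quote S σ L.eval = some R) : NextIs (E.fill L) (Valuation.dirac (E.fill R))
  | blocked {σ τ : Ty} (E : ECtx S σ τ) {L : Tm S [] σ} (hL : IsSaturated L)
      (h : ¬ σ.Obs L.eval) : NextIs (E.fill L) 0

open Classical in
/-- The kernel of the operational semantics: `Next(M)` is the valuation that the rules assign to
`M` if `M` is a redex or blocked (a term matches one rule only, with a unique evaluation context, so
that there is no choice), and `0` if `M` is normal. -/
def next {τ : Ty} (M : Tm S [] τ) : Valuation (Tm S [] τ) :=
  if h : ∃ ν, NextIs M ν then h.choose else 0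

section iterate
variable {X : Type*} [TopologicalSpace X] (κ : X → Valuation X) (N : Opens X)

open Classical in
/-- `κ^{≤0}(x)` is the Dirac valuation at `x` if `x` is in the set `N` of normal forms, and `0`
otherwise. -/
def iterZero (x : X) : Valuation X := if x ∈ N then Valuation.dirac x else 0

/-- `κ^{≤n}(x)(U)`, where `κ^{≤1}(x) = κ(x) + κ^{≤0}(x)`, and `κ^{≤n+1}(x)(U)` is the integral of
`κ^{≤n}(y)(U)` in `y` against `κ^{≤1}(x)` if `1 ≤ n`. -/
def iterLe : ℕ → X → Opens X → ℝ≥0∞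
  | 0, x, U => iterZero N x U
  | 1, x, U => (κ x + iterZero N x) U
  | n + 2, x, U => (κ x + iterZero N x).integral fun y => iterLe (n + 1) y U

/-- `κ*(x)(U)`, the supremum of `κ^{≤n}(x)(U ∩ N)` over `1 ≤ n`. -/
def iterStar (x : X) (U : Opens X) : ℝ≥0∞ := ⨆ n : ℕ, iterLe κ N (n + 1) x (U ⊓ N)

end iterate

/-- `Next*(M)(U)`. -/
def nextStar {τ : Ty} (M : Tm S [] τ) (U : Opens (Tm S [] τ)) : ℝ≥0∞ :=
  iterStar next (normalForms S τ) M U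

end operational

end ISPCF

end

open TopologicalSpace
open scoped ENNReal NNReal

noncomputable section

/-! Fix `U` and regard `[[N]](U)` as a function of the term `N`; this is `Tm.mass U`. The theorem is
a supermartingale argument for this function. One round of the operational semantics cannot increase
it on average: its integral against `Next^{≤1}(M)` is at most its value at `M` (`integral_next_le`).
On the terms `ret V` that make up `U'` it equals 1, because `[[ret V]]` is the Dirac valuation at a
point of `U`. Markov's inequality therefore bounds `Next^{≤1}(M)(U')` by `[[M]](U)`. Integrating a
bound on `Next^{≤n}` against `Next^{≤1}(M)` yields the bound on `Next^{≤n+1}` (`iterLe_le_mass`),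
and the supremum over `n` inherits it.

The supermartingale inequality is an equality for every rule that fires, while a blocked term has
successor valuation 0. For rules with a single successor of weight 1 it says that the denotation is
invariant. This rests on the fixed point equation (`SC.map_lfp`), the substitution lemma
(`Tm.den_subst`), the left unit law of the valuation monad (`eval_bind_ret`) and the correctness of
quoting (`eval_quote`); compositionality carries it through evaluation contexts.

Sampling and scoring replace the redex by a weighted family of successors, so the denotation of
`E[M]` has to depend linearly on that of `M`. This is `WCtx.integralTransfer`, and typing decides
it. The hole has a distribution type, and only `do` can be built around such a hole: the other
frames ask for a real, a function, a sum or a product, and first-order constants accept only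
arguments of basic type. Around `do`, the mass of `E[M]` is the integral against `[[M]]` of a lower
semicontinuous function that does not depend on `M`. Nested `do` frames need integration against a
Kleisli extension to be iterated integration (`SC.integral_daggerVal`). This Fubini-type law is
where minimality enters: it is checked on simple valuations and then passed to directed suprema. -/

namespace ISPCF

/-! ### Choquet integrals against continuous valuations -/

namespace Valuation
variable {X Y : Type*} [TopologicalSpace X] [TopologicalSpace Y]

/-- Change of variables: superlevel sets pull back to superlevel sets. Lower semicontinuity of `h`
makes this exact, since `superlevel` takes interiors, which preimages need not respect. -/
theorem integral_map (f : C(X, Y)) (ν : Valuation X) {h : Y → ℝ≥0∞}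
    (hh : LowerSemicontinuous h) : integral (map f ν) h = integral ν fun x => h (f x) := by
  have key : ∀ t, (superlevel h t).comap f = superlevel (fun x => h (f x)) t := by
    intro t
    ext x
    exact (mem_superlevel hh).trans (mem_superlevel (hh.comp f.continuous)).symm
  simp only [integral_eq, map_apply, key]

/-- Markov's inequality for continuous valuations. -/
theorem apply_le_integral (ν : Valuation X) {U : Opens X} {h : X → ℝ≥0∞}
    (hh : LowerSemicontinuous h) (hU : ∀ x ∈ U, 1 ≤ h x) : ν U ≤ integral ν h := by
  -- Only the levels `t < 1` are used: there `U` lies in the superlevel set, and these levels form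
  -- an interval of length one.
  have h1 : ∀ t ∈ Set.Ioo (0 : ℝ) 1, ν U ≤ ν (superlevel h t) := fun t ht =>
    ν.mono fun x hx => (mem_superlevel hh).2 (lt_of_lt_of_le
      (by rw [← ENNReal.ofReal_one]; exact (ENNReal.ofReal_lt_ofReal_iff one_pos).2 ht.2) (hU x hx))
  calc ν U = ∫⁻ _ in Set.Ioo (0 : ℝ) 1, ν U := by simp
    _ ≤ ∫⁻ t in Set.Ioo (0 : ℝ) 1, ν (superlevel h t) :=
      MeasureTheory.setLIntegral_mono' measurableSet_Ioo h1
    _ ≤ integral ν h := MeasureTheory.lintegral_mono_set Set.Ioo_subset_Ioi_self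

/-- Monotone convergence in the valuation, packaged so that it composes with Scott-continuous
families of valuations. -/
theorem scottContinuous_integral {h : X → ℝ≥0∞} (hh : LowerSemicontinuous h) :
    ScottContinuous fun ν : Valuation X => integral ν h :=
  scottContinuous_ennreal (fun _ _ hν => integral_mono_left hν h)
    fun _ hne hd _ hν => (integral_biSup_left hne hd hν hh).le

end Valuation

/-! ### Kleisli extension and least fixed points -/

namespace SC
variable {X Y : PDcpo}

/-- Inner integrals are again admissible integrands, so that integration can be iterated. -/
theorem lsc_integral (f : SC X (PDcpo.dist Y)) {g : Y → ℝ≥0∞} (hg : LowerSemicontinuous g) :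
    LowerSemicontinuous fun x => (PDcpo.val (f x)).integral g :=
  lsc_of_scott ((f.scott.comp (scottContinuous_val Y)).comp (Valuation.scottContinuous_integral hg))

/-- Integration against the extension of a Kleisli map is iterated integration. -/
theorem integral_daggerVal (f : SC X (PDcpo.dist Y)) {g : Y → ℝ≥0∞}
    (hg : LowerSemicontinuous g) {μ : Valuation X} (hμ : μ.IsMinimal) :
    (daggerVal f μ hμ).integral g = μ.integral fun x => (PDcpo.val (f x)).integral g := by
  induction hμ with
  | simple ν hν =>
    -- Minimality is carried along in the predicate because `daggerVal` takes a proof of it as an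
    -- argument.
    have h := hν.induction (P := fun ν => ν.IsMinimal ∧ ∀ h : ν.IsMinimal,
        (daggerVal f ν h).integral g = ν.integral fun x => (PDcpo.val (f x)).integral g)
      ⟨Valuation.isMinimal_zero, fun h => by
        have : daggerVal f 0 h = 0 := by ext U; simp [daggerVal]
        simp [this]⟩ ?_
    · exact h.2 _
    · rintro μ r x ⟨hμ, ih⟩
      refine ⟨hμ.add ((Valuation.isMinimal_dirac x).smul r), fun h => ?_⟩
      -- The extension is additive in the valuation and sends `δ_x` to `f x`, so the added Dirac
      -- term contributes `r` times the integral of `g` against `f x` on both sides.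
      have : daggerVal f _ h = daggerVal f μ hμ + (r : ℝ≥0∞) • PDcpo.val (f x) := by
        ext U
        simp [daggerVal, Valuation.integral_add_left, Valuation.integral_smul_left,
          Valuation.integral_dirac (f.lsc_dist U)]
      simp [this, Valuation.integral_add_left, Valuation.integral_smul_left, ih hμ,
        Valuation.integral_dirac (f.lsc_integral hg)]
  | dirSup d hne hd hmin ν hν ih =>
    -- The family is indexed by the subtype, since the extension of `μ` exists only with the
    -- minimality proof that membership in `d` supplies.
    let F : d → Valuation Y := fun μ => daggerVal f μ (hmin μ μ.2)
    have hdir : DirectedOn (· ≤ ·) (Set.range F) := by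
      rintro _ ⟨a, rfl⟩ _ ⟨b, rfl⟩
      obtain ⟨c, hc, h1, h2⟩ := hd a a.2 b b.2
      exact ⟨_, ⟨⟨c, hc⟩, rfl⟩, fun U => Valuation.integral_mono_left h1 _,
        fun U => Valuation.integral_mono_left h2 _⟩
    have : Nonempty d := hne.to_subtype
    -- The extension preserves the directed supremum: on each open set this is monotone convergence
    -- for `ν`. Both sides of the goal then become suprema over `d`, to be compared term by term.
    have hlub : IsLUB (Set.range F) (daggerVal f ν (.dirSup d hne hd hmin ν hν)) := by
      refine (Valuation.isLUB_iff hdir).2 fun U => ?_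
      rw [iSup_range, iSup_subtype]
      exact Valuation.integral_biSup_left hne hd hν (f.lsc_dist U)
    rw [Valuation.integral_biSup_left (Set.range_nonempty F) hdir hlub hg, iSup_range,
      Valuation.integral_biSup_left hne hd hν (f.lsc_integral hg), iSup_subtype]
    exact iSup_congr fun μ => iSup_congr fun hμ => ih μ hμ

/-- Kleene's argument: by continuity `f` maps the supremum of the iterates to the supremum of the
chain shifted by one, and shifting an increasing chain does not change its supremum. -/
theorem map_lfp (f : SC X X) : f f.lfp = f.lfp := by
  have h := f.scott (Set.range_nonempty _) f.iterate_directed f.isLUB_lfp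
  refine h.unique ⟨?_, fun b hb => f.isLUB_lfp.2 ?_⟩
  · rintro _ ⟨_, ⟨n, rfl⟩, rfl⟩
    exact f.isLUB_lfp.1 ⟨n + 1, Function.iterate_succ_apply' _ _ _⟩
  · rintro _ ⟨n, rfl⟩
    -- The iterate of index 0 is missing from the shifted chain, so each iterate is bounded through
    -- its successor, which does belong to it.
    refine (f.iterate_le_succ n).trans (hb ⟨_, ⟨n, rfl⟩, ?_⟩)
    exact (Function.iterate_succ_apply' _ _ _).symm

end SC

namespace Tm
variable {S : Signature}

/-! ### Renaming and substitution -/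

/-- The two environments are only required to agree on variables through `f`. This relation survives
extending both by the same value, which is what lets the induction pass under `lam` and `bind`. -/
theorem den_rename {Γ Δ : List Ty} {τ : Ty} (M : Tm S Γ τ) (f : ∀ σ, Var Γ σ → Var Δ σ)
    (γ : ctxDen Γ) (δ : ctxDen Δ) (h : ∀ σ x, (f σ x).den δ = x.den γ) :
    (M.rename f).den δ = M.den γ := by
  have lift : ∀ {Γ Δ : List Ty} {f : ∀ σ, Var Γ σ → Var Δ σ} {γ : ctxDen Γ} {δ : ctxDen Δ},
      (∀ σ x, (f σ x).den δ = x.den γ) → ∀ (ρ : Ty) (v : ρ.den) (σ : Ty) (x : Var (ρ :: Γ) σ),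
      (liftRen f σ x).den ((v, δ) : ρ.den × ctxDen Δ) = x.den ((v, γ) : ρ.den × ctxDen Γ) := by
    intro Γ Δ f γ δ h ρ v σ x
    cases x with
    | zero => rfl
    | succ x => exact h _ x
  induction M generalizing Δ with
  | var x => exact h _ x
  | star | int | real | con | sample => rfl
  | score M ih => exact congrArg SC.score.toFun (ih f γ δ h)
  | lam M ih => exact SC.ext (funext fun v => ih _ _ _ (lift h _ v))
  | app M N ih ih' => exact congrArg SC.app.toFun (Prod.ext (ih f γ δ h) (ih' f γ δ h))
  | fix M ih => exact congrArg SC.fix.toFun (ih f γ δ h)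
  | ret M ih => exact congrArg SC.ret.toFun (ih f γ δ h)
  | bind M N ih ih' =>
    exact congrArg SC.bind.toFun
      (Prod.ext (SC.ext (funext fun v => ih' _ _ _ (lift h _ v))) (ih f γ δ h))
  | pair M N ih ih' => exact Prod.ext (ih f γ δ h) (ih' f γ δ h)
  | fst M ih => exact congrArg Prod.fst (ih f γ δ h)
  | snd M ih => exact congrArg Prod.snd (ih f γ δ h)
  | inl M ih => exact congrArg SC.inl.toFun (ih f γ δ h)
  | inr M ih => exact congrArg SC.inr.toFun (ih f γ δ h)
  | case M N P ih ih' ih'' =>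
    exact congrArg SC.case.toFun
      (Prod.ext (ih f γ δ h) (Prod.ext (ih' f γ δ h) (ih'' f γ δ h)))

/-- The substitution lemma, proved by the same scheme: `γ` has to hold the values at `δ` of the
substituted terms. It is stated for arbitrary contexts, although only closed instances are needed,
because binders enlarge both contexts. -/
theorem den_subst {Γ Δ : List Ty} {τ : Ty} (M : Tm S Γ τ) (f : ∀ σ, Var Γ σ → Tm S Δ σ)
    (γ : ctxDen Γ) (δ : ctxDen Δ) (h : ∀ σ x, (f σ x).den δ = x.den γ) :
    (M.subst f).den δ = M.den γ := by
  have lift : ∀ {Γ Δ : List Ty} {f : ∀ σ, Var Γ σ → Tm S Δ σ} {γ : ctxDen Γ} {δ : ctxDen Δ},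
      (∀ σ x, (f σ x).den δ = x.den γ) → ∀ (ρ : Ty) (v : ρ.den) (σ : Ty) (x : Var (ρ :: Γ) σ),
      (liftSubst f σ x).den ((v, δ) : ρ.den × ctxDen Δ) = x.den ((v, γ) : ρ.den × ctxDen Γ) := by
    intro Γ Δ f γ δ h ρ v σ x
    cases x with
    | zero => rfl
    | succ x =>
      -- Under a binder the substituted term is weakened, and a weakened term ignores the new value
      -- `v`.
      exact (den_rename (f _ x) (fun _ => Var.succ) δ ((v, δ) : ρ.den × ctxDen Δ)
        fun _ _ => rfl).trans (h _ x)
  induction M generalizing Δ with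
  | var x => exact h _ x
  | star | int | real | con | sample => rfl
  | score M ih => exact congrArg SC.score.toFun (ih f γ δ h)
  | lam M ih => exact SC.ext (funext fun v => ih _ _ _ (lift h _ v))
  | app M N ih ih' => exact congrArg SC.app.toFun (Prod.ext (ih f γ δ h) (ih' f γ δ h))
  | fix M ih => exact congrArg SC.fix.toFun (ih f γ δ h)
  | ret M ih => exact congrArg SC.ret.toFun (ih f γ δ h)
  | bind M N ih ih' =>
    exact congrArg SC.bind.toFun
      (Prod.ext (SC.ext (funext fun v => ih' _ _ _ (lift h _ v))) (ih f γ δ h))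
  | pair M N ih ih' => exact Prod.ext (ih f γ δ h) (ih' f γ δ h)
  | fst M ih => exact congrArg Prod.fst (ih f γ δ h)
  | snd M ih => exact congrArg Prod.snd (ih f γ δ h)
  | inl M ih => exact congrArg SC.inl.toFun (ih f γ δ h)
  | inr M ih => exact congrArg SC.inr.toFun (ih f γ δ h)
  | case M N P ih ih' ih'' =>
    exact congrArg SC.case.toFun
      (Prod.ext (ih f γ δ h) (Prod.ext (ih' f γ δ h) (ih'' f γ δ h)))

/-- Substitution of a closed term is evaluation of the denotation at its value. -/
theorem eval_inst {σ τ : Ty} (M : Tm S [σ] τ) (N : Tm S [] σ) :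
    (M.inst N).eval = M.den ((N.eval, PUnit.unit) : σ.den × ctxDen []) := by
  refine den_subst M _ _ _ fun ρ x => ?_
  cases x with
  | zero => rfl
  | succ x => cases x

end Tm

section soundness
variable {S : Signature}

/-! ### Invariance of the denotation under deterministic steps -/

/-- Unfolding `rec` is the fixed point equation and beta reduction is the substitution lemma;
projections and case analysis of injections compute semantically. -/
theorem DetStep.eval_eq {τ : Ty} {L R : Tm S [] τ} (h : DetStep L R) : L.eval = R.eval := by
  cases h with
  | fix M => exact (SC.map_lfp (PDcpo.toSC M.eval)).symm
  | beta M N => exact (M.eval_inst N).symm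
  | fst M N => rfl
  | snd M N => rfl
  | inl M N P => rfl
  | inr M N P => rfl

/-- This is why the rule for constants preserves denotations: its redex is replaced by the quotation
of that redex's own value. Where quotation fails, as at function and distribution types, there is
nothing to prove. -/
theorem eval_quote {τ : Ty} {v : τ.den} {R : Tm S [] τ} (h : quote S τ v = some R) :
    R.eval = v := by
  induction τ with
  | unit =>
    rcases v with _ | v
    · cases h
    · cases h; rfl
  | void => cases h
  | int =>
    rcases v with _ | v
    · cases h
    · cases h; rfl
  | real =>
    rcases v with _ | v
    · cases h
    · cases h; rfl
  | sum σ τ ih ih' =>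
    rcases v with _ | (v | v)
    · cases h
    · obtain ⟨M, hM, rfl⟩ := Option.map_eq_some_iff.1 h
      exact congrArg SC.inl.toFun (ih hM)
    · obtain ⟨M, hM, rfl⟩ := Option.map_eq_some_iff.1 h
      exact congrArg SC.inr.toFun (ih' hM)
  | prod σ τ ih ih' =>
    rcases v with ⟨a, b⟩
    change (match quote S σ a, quote S τ b with
      | some M, some N => some (Tm.pair M N)
      | _, _ => none) = some R at h
    cases ha : quote S σ a with
    | none => simp [ha] at h
    | some M =>
      cases hb : quote S τ b with
      | none => simp [ha, hb] at h
      | some N =>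
        simp only [ha, hb, Option.some.injEq] at h
        subst h
        exact Prod.ext (ih ha) (ih' hb)
  | arr σ τ => cases h
  | dist τ => cases h

/-- Compositionality: the hole never lies under a binder, so only the value of the closed term
placed there matters. -/
theorem WCtx.eval_fill_congr {σ τ : Ty} (E : WCtx S σ τ) {L R : Tm S [] σ}
    (h : L.eval = R.eval) : (E.fill L).eval = (E.fill R).eval := by
  induction E with
  | hole => exact h
  | score E ih => exact congrArg SC.score.toFun ih
  | app E N ih => exact congrArg SC.app.toFun (Prod.ext ih rfl)
  | bind E N ih => exact congrArg SC.bind.toFun (Prod.ext rfl ih)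
  | arg M c i hM hi E ih => exact congrArg SC.app.toFun (Prod.ext rfl ih)
  | case E N P ih => exact congrArg SC.case.toFun (Prod.ext ih rfl)
  | fst E ih => exact congrArg Prod.fst ih
  | snd E ih => exact congrArg Prod.snd ih

theorem ECtx.eval_fill_congr {σ τ : Ty} (E : ECtx S σ τ) {L R : Tm S [] σ}
    (h : L.eval = R.eval) : (E.fill L).eval = (E.fill R).eval := by
  induction E with
  | weak E => exact E.eval_fill_congr h
  | ret E ih => exact congrArg SC.ret.toFun ih
  | pairLeft E N ih => exact Prod.ext ih rfl
  | pairRight V hV E ih => exact Prod.ext rfl ih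
  | inl E ih => exact congrArg SC.inl.toFun ih
  | inr E ih => exact congrArg SC.inr.toFun ih

/-- The left unit law of the monad: integrating against a Dirac valuation evaluates at its point,
and the substitution lemma identifies the result. -/
theorem eval_bind_ret {σ τ : Ty} (M : Tm S [] σ) (N : Tm S [σ] (Ty.dist τ)) :
    (Tm.bind (Tm.ret M) N).eval = (N.inst M).eval := by
  rw [Tm.eval_inst]
  refine Subtype.ext (Valuation.ext fun U => ?_)
  exact Valuation.integral_dirac ((PDcpo.toSC (N.den.curry PUnit.unit)).lsc_dist U) M.eval

/-! ### Evaluation contexts around terms of distribution type -/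

/-- Each argument strips one arrow from a first-order type and leaves a first-order type.
Consequently the next argument of a partially applied constant has a basic type, never a
distribution type. -/
theorem Spine.isFirstOrder (hS : S.StrictlyObservable) {c : S.Con} {i : ℕ} {τ : Ty}
    {M : Tm S [] τ} (h : Spine c i M) : τ.IsFirstOrder := by
  induction h with
  | con h => exact h ▸ hS.firstOrder c
  | app _ _ ih =>
    cases ih with
    | obs h => exact h.elim
    | arr _ h => exact h

/-- For a weak evaluation context `E` of type `D τ` with a hole of type `D σ`, integrals against the
denotation of `E[M]` are integrals against the denotation of `M`. -/
def WCtx.IntegralTransfer {σ : Ty} : {τ : Ty} → WCtx S (Ty.dist σ) τ → Prop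
  | Ty.dist τ, E => ∀ g : τ.den → ℝ≥0∞, LowerSemicontinuous g → ∃ k : σ.den → ℝ≥0∞,
      LowerSemicontinuous k ∧ ∀ M : Tm S [] (Ty.dist σ),
        (PDcpo.val (E.fill M).eval).integral g = (PDcpo.val M.eval).integral k
  | _, _ => False

/-- As `IntegralTransfer` is `False` at other types, the induction also shows that `τ` is a
distribution type, and this excludes every frame but `do`. The quantification over all lower
semicontinuous `g` is forced by `do`, which turns an indicator into a general integrand. The
function `k` does not depend on `M`, so the same `k` serves a redex and all of its successors. -/
theorem WCtx.integralTransfer (hS : S.StrictlyObservable) {σ τ : Ty} (E : WCtx S (Ty.dist σ) τ) :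
    E.IntegralTransfer := by
  induction E with
  | hole => exact fun g hg => ⟨g, hg, fun _ => rfl⟩
  | score E ih => exact ih.elim
  | app E N ih => exact ih.elim
  | bind E N ih =>
    intro g hg
    let f := PDcpo.toSC (N.den.curry PUnit.unit)
    obtain ⟨k, hk, h⟩ := ih _ (f.lsc_integral hg)
    -- The integral of `g` against the extension of `f` is the integral of `x ↦ ∫ g d(f x)` against
    -- the denotation of `E[M]`; the induction hypothesis applies to this new integrand.
    exact ⟨k, hk, fun M => (f.integral_daggerVal hg (PDcpo.val_minimal _)).trans (h M)⟩
  | @arg ρ τ M c i hM hi E ih =>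
    cases hM.isFirstOrder hS with
    | obs h => exact h.elim
    -- The hole of this frame would have the basic type `ρ`: at basic types the induction hypothesis
    -- is `False`, and at all others `h` is.
    | arr h _ => cases ρ <;> first | exact ih.elim | exact h.elim
  | case E N P ih => exact ih.elim
  | fst E ih => exact ih.elim
  | snd E ih => exact ih.elim

/-! ### Soundness -/

/-- The mass that the denotation of a term gives to an open set. -/
def Tm.mass {τ : Ty} (U : Opens τ.den) (M : Tm S [] (Ty.dist τ)) : ℝ≥0∞ := PDcpo.val M.eval U

/-- Needed for integrals of the mass over the space of terms to behave: Dirac evaluation, change of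
variables and Markov's inequality all ask for it. It comes from the Scott continuity of `Tm.eval`.
-/
theorem Tm.lsc_mass {τ : Ty} (U : Opens τ.den) :
    LowerSemicontinuous (Tm.mass (S := S) U) := by
  have h : ScottContinuous (Tm.mass (S := S) U) :=
    (Tm.eval_scott.comp (scottContinuous_val τ.den)).comp (Valuation.scottContinuous_eval U)
  rw [lowerSemicontinuous_iff_isOpen_preimage]
  refine fun y => Tm.isOpen_iff.2 ⟨fun a b hab ha => lt_of_lt_of_le ha (h.monotone hab), ?_⟩
  intro d hd hdir a ha hya
  obtain ⟨_, ⟨c, hc, rfl⟩, hb⟩ := (lt_isLUB_iff (h hd hdir ha)).1 hya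
  exact ⟨c, hc, hb⟩

/-! ### Indicators of open sets as integrands -/

theorem PDcpo.lsc_indicator {X : PDcpo} (U : Opens X) :
    LowerSemicontinuous fun x : X => Valuation.dirac x U :=
  SC.ret.lsc_dist U

/-- With the indicator of `U` written as `x ↦ δ_x(U)`, this turns the mass of an open set into an
integral, to which `WCtx.integralTransfer` applies. -/
theorem PDcpo.integral_indicator {X : PDcpo} (ν : Valuation X) (U : Opens X) :
    ν.integral (fun x => Valuation.dirac x U) = ν U := by
  classical
  -- The superlevel set is `U` at levels below 1 and empty from level 1 on.
  have key : ∀ t : ℝ, 0 < t → ν (Valuation.superlevel (fun x => Valuation.dirac x U) t) =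
      (if ENNReal.ofReal t < 1 then 1 else 0) * ν U := by
    intro t ht
    split_ifs with h
    · rw [one_mul]
      congr 1
      ext x
      refine (Valuation.mem_superlevel (PDcpo.lsc_indicator U)).trans ?_
      rw [Valuation.dirac_apply]
      by_cases hx : x ∈ U <;> simp [hx, h]
    · rw [zero_mul, ← ν.strict]
      congr 1
      ext x
      refine (Valuation.mem_superlevel (PDcpo.lsc_indicator U)).trans ?_
      rw [Valuation.dirac_apply]
      by_cases hx : x ∈ U <;> simp [hx, h]
  rw [Valuation.integral_eq, MeasureTheory.setLIntegral_congr_fun measurableSet_Ioi key,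
    MeasureTheory.lintegral_mul_const, lintegral_indicator_lt, one_mul]
  exact Measurable.ite (measurableSet_lt (by fun_prop) measurable_const) measurable_const
    measurable_const

/-! ### The supermartingale inequality -/

theorem NextIs.integral_mass_le (hS : S.StrictlyObservable) {τ : Ty} (U : Opens τ.den)
    {M : Tm S [] (Ty.dist τ)} {ν : Valuation (Tm S [] (Ty.dist τ))} (h : NextIs M ν) :
    ν.integral (Tm.mass U) ≤ Tm.mass U M := by
  have hU := Tm.lsc_mass (S := S) U
  -- Seen through a weak context, the mass is linear in the valuation denoted by the term in the
  -- hole; this handles sampling and scoring.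
  have transfer : ∀ {σ : Ty} (E : WCtx S (Ty.dist σ) (Ty.dist τ)), ∃ k : σ.den → ℝ≥0∞,
      LowerSemicontinuous k ∧ ∀ M, Tm.mass U (E.fill M) = (PDcpo.val M.eval).integral k := by
    intro σ E
    obtain ⟨k, hk, h⟩ := E.integralTransfer hS _ (PDcpo.lsc_indicator U)
    exact ⟨k, hk, fun M => (PDcpo.integral_indicator _ U).symm.trans (h M)⟩
  cases h with
  | sample E μ h =>
    obtain ⟨k, hk, h⟩ := transfer E
    rw [Valuation.integral_map _ _ hU, h]
    -- Both sides are the integral of `a ↦ k [a, a]` against `μ`. On the right this is a change of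
    -- variables in the definition of `sampleVal`; on the left, `E[ret a]` has mass `k [a, a]`.
    refine le_of_eq (.trans ?_ (Valuation.integral_map _ _ hk).symm)
    congr 1
    funext a
    exact (h _).trans (Valuation.integral_dirac hk _)
  | score E a =>
    obtain ⟨k, hk, h⟩ := transfer E
    rw [Valuation.integral_smul_left, Valuation.integral_dirac hU, h, h]
    -- Scoring denotes `|a|` times the denotation of `ret *`, so the factor is pulled out of the
    -- integral of `k`.
    refine le_of_eq (.trans ?_ (Valuation.integral_smul_left _ _ _).symm)
    rfl
  | bind E M N =>
    rw [Valuation.integral_dirac hU]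
    exact (congrArg (fun ν => PDcpo.val ν U) (E.eval_fill_congr (eval_bind_ret M N))).ge
  | det E h =>
    rw [Valuation.integral_dirac hU]
    exact (congrArg (fun ν => PDcpo.val ν U) (E.eval_fill_congr h.eval_eq)).ge
  | con E hL hR =>
    rw [Valuation.integral_dirac hU]
    exact (congrArg (fun ν => PDcpo.val ν U) (E.eval_fill_congr (eval_quote hR))).le
  | blocked E hL h => simp

/-- Keeps the two summands of `Next^{≤1}(M)` from both contributing, which could count the mass of
`M` twice. -/
theorem NextIs.not_isNormal {τ : Ty} {M : Tm S [] τ} {ν : Valuation (Tm S [] τ)}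
    (h : NextIs M ν) : ¬ IsNormal M := by
  rintro ⟨h1, h2⟩
  cases h with
  -- The outcome 0 is arbitrary: any real number witnesses that the term is a redex.
  | sample E μ h => exact h1 ⟨_, .sample E μ h 0⟩
  | score E a => exact h1 ⟨_, .score E a⟩
  | bind E M N => exact h1 ⟨_, .bind E M N⟩
  | det E h => exact h1 ⟨_, .det E h⟩
  | con E hL hR => exact h1 ⟨_, .con E hL hR⟩
  | blocked E hL h => exact h2 ⟨_, E, _, hL, h, rfl⟩

theorem integral_next_le (hS : S.StrictlyObservable) {τ : Ty} (U : Opens τ.den)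
    (M : Tm S [] (Ty.dist τ)) :
    (next M + iterZero (normalForms S _) M).integral (Tm.mass U) ≤ Tm.mass U M := by
  rw [Valuation.integral_add_left]
  -- The valuation `next M` is a chosen witness. The mass bound holds for every valuation the rules
  -- assign to `M`, so uniqueness of the matching rule plays no role.
  by_cases h : ∃ ν, NextIs M ν
  · have hM : M ∉ normalForms S _ := h.choose_spec.not_isNormal
    rw [next, dif_pos h, iterZero, if_neg hM, Valuation.integral_zero_left, add_zero]
    exact h.choose_spec.integral_mass_le hS U
  · rw [next, dif_neg h, Valuation.integral_zero_left, zero_add, iterZero]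
    split_ifs
    · exact (Valuation.integral_dirac (Tm.lsc_mass U) M).le
    · simp

/-- Iterating the supermartingale inequality: the bound for all successors is integrated against one
round of the semantics. The index is `n + 1` because `Next*` is a supremum from the first iterate
on. -/
theorem iterLe_le_mass (hS : S.StrictlyObservable) {τ : Ty} (U : Opens τ.den) (n : ℕ)
    (M : Tm S [] (Ty.dist τ)) :
    iterLe next (normalForms S _) (n + 1) M (rover U ⊓ normalForms S _) ≤ Tm.mass U M := by
  induction n generalizing M with
  | zero =>
    -- Markov's inequality with the mass as test function: it is at least 1 on the open set, since
    -- `[[ret V]]` is the Dirac valuation at a point of `U`.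
    refine le_trans (Valuation.apply_le_integral _ (Tm.lsc_mass U) ?_) (integral_next_le hS U M)
    rintro _ ⟨⟨V, rfl, -, hV⟩, -⟩
    exact (if_pos hV).ge
  | succ n ih =>
    -- Monotonicity of the Choquet integral holds for arbitrary integrands, so no semicontinuity of
    -- the iterates is required.
    exact le_trans (Valuation.integral_mono_right _ ih) (integral_next_le hS U M)

end soundness

end ISPCF

end

theorem mainTheorem5 (S : ISPCF.Signature) (hS : S.StrictlyObservable) (τ : ISPCF.Ty)
    (M : ISPCF.Tm S [] (ISPCF.Ty.dist τ)) (U : TopologicalSpace.Opens τ.den) :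
    ISPCF.nextStar M (ISPCF.rover U) ≤ ISPCF.PDcpo.val M.eval U :=
  iSup_le fun n => ISPCF.iterLe_le_mass hS U n M
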